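/- A monad $\mathbb S=(S,\eta,\mu)$ on the category $\mathbf{Set}$ is \emph{consistent} if $\eta_X\colon X\to SX$ is injective for every set $X$. The \emph{Trnková closure} $\hat{\mathbb S}$ of a monad $\mathbb S$ is the monad whose functor $\hat S$ agrees with $S$ on nonempty sets and functions between them, whose value $\hat S\emptyset$ is the equalizer of the two maps $S1\rightrightarrows S2$ induced by the two functions $1\rightrightarrows 2$, and whose monad structure is the unique one for which the canonical natural transformation $S\to\hat S$ (the identity on nonempty sets) is a monad morphism. The monad $\mathbb S$ is \emph{substantially exceptional} if $\hat{\mathbb S}$ is isomorphic, as a monad, to the exception monad $\mathbb M_E\colon X\mapsto X+E$ for some set $E$ (equivalently, $\mathbb S$ is isomorphic to $\mathbb M_E$ or to its submonad $\mathbb M_E^0$ with $\emptyset\mapsto\emptyset$ and $X\mapsto X+E$ for $X\neq\emptyset$). \textbf{Theorem.} Let $\mathbb S$ and $\mathbb T$ be consistent monads on $\mathbf{Set}$. Then $\mathbb S$ and $\mathbb T$ have a coproduct in the category of monads on $\mathbf{Set}$ and monad morphisms if and only if at least one of the following holds: \begin{enumerate} \item $\mathbb S$ or $\mathbb T$ is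 substantially exceptional; \item $\mathbb S$ and $\mathbb T$ have arbitrarily large joint fixpoints, i.e. for every cardinal $\kappa$ there is a cardinal $\lambda\ge\kappa$ with $|S\lambda|=\lambda=|T\lambda|$. \end{enumerate} -/

import Mathlib

universe u

namespace SetMonad

open CategoryTheory CategoryTheory.Limits Cardinal

/-- A monad on the category of sets is consistent when all components of its unit are injective. -/
def IsConsistent (S : Monad (Type u)) : Prop :=
  ∀ X : Type u, Function.Injective (S.η.app X)

/-- The cardinal `κ` is a fixpoint of the set functor `H` when `|H κ| = κ`. Here `κ.out` is a
chosen set of cardinality `κ`. -/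
def IsFixpoint (H : Type u ⥤ Type u) (κ : Cardinal.{u}) : Prop :=
  #(H.obj κ.out) = κ

/-- Two set functors have arbitrarily large joint fixpoints. -/
def HaveArbitrarilyLargeJointFixpoints (H K : Type u ⥤ Type u) : Prop :=
  ∀ κ : Cardinal.{u}, ∃ l : Cardinal.{u}, κ ≤ l ∧ IsFixpoint H l ∧ IsFixpoint K l

/-! ### The Trnková closure of a set functor -/

/-- The value at `X` of the Trnková closure of a set functor `H`: the equalizer of the two maps
`H (X + 1) ⟶ H (X + 1 + 1)` induced by the two inclusions of `X + 1` into `X + 1 + 1` that are the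
evident one on `X`. For `X` empty this is the equalizer of the two maps `H 1 ⟶ H 2`
(see `trnkovaEmptyEquiv`), and for `X` nonempty it is canonically `H X`
(see `trnkovaReflection_bijective`). -/
def TrnkovaObj (H : Type u ⥤ Type u) (X : Type u) : Type u :=
  {p : H.obj (Option X) //
    H.map (↾(some : Option X → Option (Option X))) p =
      H.map (↾(Option.map some : Option X → Option (Option X))) p}

theorem map_map (H : Type u ⥤ Type u) {X Y Z : Type u} (f : X → Y) (g : Y → Z) (p : H.obj X) :
    H.map (↾g) (H.map (↾f) p) = H.map (↾(g ∘ f)) p := by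
  have h : (↾(g ∘ f) : X ⟶ Z) = (↾f : X ⟶ Y) ≫ (↾g : Y ⟶ Z) := rfl
  rw [h, H.map_comp]
  rfl

theorem map_id (H : Type u ⥤ Type u) {X : Type u} (f : X → X) (hf : ∀ x, f x = x) (p : H.obj X) :
    H.map (↾f) p = p := by
  have h : (↾f : X ⟶ X) = 𝟙 X := by
    ext x
    exact hf x
  rw [h, H.map_id]
  rfl

/-- The action of the Trnková closure on maps. -/
def trnkovaMap (H : Type u ⥤ Type u) {X Y : Type u} (f : X → Y) (p : TrnkovaObj H X) :
    TrnkovaObj H Y :=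
  ⟨H.map (↾(Option.map f)) p.1, by
    have h := congrArg (H.map (↾(Option.map (Option.map f)))) p.2
    rw [map_map, map_map] at h
    rw [map_map, map_map]
    have h1 : (some ∘ Option.map f : Option X → Option (Option Y)) =
        Option.map (Option.map f) ∘ some := rfl
    have h2 : (Option.map some ∘ Option.map f : Option X → Option (Option Y)) =
        Option.map (Option.map f) ∘ Option.map some := by
      funext x; cases x <;> rfl
    rw [h1, h2, h]⟩

/-- The Trnková closure of a set functor. -/
def trnkovaFunctor (H : Type u ⥤ Type u) : Type u ⥤ Type u where
  obj X := TrnkovaObj H X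
  map f := ↾(trnkovaMap H f)
  map_id X := by
    ext p
    refine Subtype.ext (map_id H _ (fun x => ?_) p.1)
    cases x <;> rfl
  map_comp {X Y Z} f g := by
    ext p
    refine Subtype.ext (Eq.trans ?_ (map_map H (Option.map f) (Option.map g) p.1).symm)
    have h : (Option.map (f ≫ g : X ⟶ Z) : Option X → Option Z) = Option.map g ∘ Option.map f := by
      funext x; cases x <;> rfl
    change H.map (↾(Option.map (f ≫ g : X ⟶ Z))) p.1 = _
    rw [h]

/-- The component at `X` of the reflection of `H` into its Trnková closure. -/
def trnkovaReflection (H : Type u ⥤ Type u) (X : Type u) (p : H.obj X) : TrnkovaObj H X :=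
  ⟨H.map (↾some) p, by rw [map_map, map_map]⟩

/-- A set functor agrees with its Trnková closure on nonempty sets. -/
theorem trnkovaReflection_bijective (H : Type u ⥤ Type u) (X : Type u) [Nonempty X] :
    Function.Bijective (trnkovaReflection H X) := by
  obtain ⟨x₀⟩ := ‹Nonempty X›
  let r : Option X → X := fun o => o.getD x₀
  constructor
  · intro p q h
    have h1 := congrArg (H.map (↾r)) (congrArg Subtype.val h)
    change H.map (↾r) (H.map (↾some) p) = H.map (↾r) (H.map (↾some) q) at h1
    rwa [map_map, map_map, map_id H _ (fun _ => rfl), map_id H _ (fun _ => rfl)] at h1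
  · intro p
    refine ⟨H.map (↾r) p.1, Subtype.ext ?_⟩
    have h := congrArg (H.map (↾(Option.map r))) p.2
    rw [map_map, map_map, map_id H (Option.map r ∘ Option.map some)
      (fun x => by cases x <;> rfl)] at h
    change H.map (↾some) (H.map (↾r) p.1) = p.1
    rw [map_map]
    exact h

/-- On the empty set, the Trnková closure is the equalizer of the images under `H` of the two
maps from a one-point set to a two-point set. -/
noncomputable def trnkovaEmptyEquiv (H : Type u ⥤ Type u) (X : Type u) [IsEmpty X] :
    TrnkovaObj H X ≃
      {p : H.obj PUnit.{u + 1} //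
        H.map (↾fun _ : PUnit.{u + 1} => (ULift.up.{u} true)) p =
          H.map (↾fun _ : PUnit.{u + 1} => (ULift.up.{u} false)) p} where
  toFun p := ⟨H.map (↾fun _ => PUnit.unit) p.1, by
    have h := congrArg
      (H.map (↾fun o : Option (Option X) => ULift.up.{u} (o.isSome))) p.2
    rw [map_map, map_map] at h
    rw [map_map, map_map]
    refine Eq.trans ?_ (h.trans ?_)
    · rfl
    · refine congrArg (fun f => H.map (↾f) p.1) (funext fun o => ?_)
      cases o with
      | none => rfl
      | some x => exact isEmptyElim x⟩
  invFun p := ⟨H.map (↾fun _ => none) p.1, by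
    have h := congrArg
      (H.map (↾fun b : ULift.{u} Bool => bif b.down then (some none : Option (Option X)) else none))
      p.2
    rw [map_map, map_map] at h
    rw [map_map, map_map]
    exact h⟩
  left_inv p := by
    refine Subtype.ext ?_
    change H.map (↾fun _ => none) (H.map (↾fun _ => PUnit.unit) p.1) = p.1
    rw [map_map, map_id]
    intro o
    cases o with
    | none => rfl
    | some x => exact isEmptyElim x
  right_inv p := by
    refine Subtype.ext ?_
    change H.map (↾fun _ => PUnit.unit) (H.map (↾fun _ => none) p.1) = p.1
    rw [map_map, map_id]
    intro o
    rfl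

/-! ### The Trnková closure of a monad -/

/-- Kleisli extension for a monad on the category of sets. -/
def bind (S : Monad (Type u)) {X Y : Type u} (f : X → S.obj Y) (p : S.obj X) : S.obj Y :=
  S.μ.app Y (S.map (↾f) p)

section

variable (S : Monad (Type u))

theorem map_eta {X Y : Type u} (f : X → Y) (x : X) :
    S.map (↾f) (S.η.app X x) = S.η.app Y (f x) :=
  (ConcreteCategory.congr_hom (S.η.naturality (↾f)) x).symm

theorem bind_eta {X Y : Type u} (f : X → S.obj Y) (x : X) : bind S f (S.η.app X x) = f x := by
  unfold bind
  rw [map_eta]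
  exact ConcreteCategory.congr_hom (S.left_unit Y) (f x)

theorem eta_bind {X : Type u} (f : X → S.obj X) (hf : ∀ x, f x = S.η.app X x) (p : S.obj X) :
    bind S f p = p := by
  have h : f = S.η.app X := funext hf
  subst h
  exact ConcreteCategory.congr_hom (S.right_unit X) p

theorem bind_map {X Y Z : Type u} (h : X → Y) (f : Y → S.obj Z) (p : S.obj X) :
    bind S f (S.map (↾h) p) = bind S (f ∘ h) p := by
  unfold bind
  exact congrArg (S.μ.app Z) (map_map S.toFunctor h f p)

theorem map_bind {X Y Z : Type u} (f : X → S.obj Y) (h : Y → Z) (p : S.obj X) :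
    S.map (↾h) (bind S f p) = bind S (fun x => S.map (↾h) (f x)) p := by
  unfold bind
  have h1 := ConcreteCategory.congr_hom (S.μ.naturality (↾h)) (S.map (↾f) p)
  refine h1.symm.trans (congrArg (S.μ.app Z) ?_)
  exact map_map S.toFunctor f (S.map (↾h)) p

theorem bind_bind {X Y Z : Type u} (f : X → S.obj Y) (g : Y → S.obj Z) (p : S.obj X) :
    bind S g (bind S f p) = bind S (fun x => bind S g (f x)) p := by
  have h1 : bind S g (bind S f p) =
      S.μ.app Z (bind S (fun x => S.map (↾g) (f x)) p) :=
    congrArg (S.μ.app Z) (map_bind S f g p)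
  rw [h1]
  unfold bind
  refine (ConcreteCategory.congr_hom (S.assoc Z)
    (S.map (↾(fun x => S.map (↾g) (f x))) p)).symm.trans ?_
  exact congrArg (S.μ.app Z) (map_map S.toFunctor _ (S.μ.app Z) p)

/-- Elements of the Trnková closure at `X` do not depend on the additional point of `X + 1`. -/
theorem bind_congr {X Y : Type u} (p : TrnkovaObj S.toFunctor X) (g g' : Option X → S.obj Y)
    (h : ∀ x, g (some x) = g' (some x)) : bind S g p.1 = bind S g' p.1 := by
  let k : Option (Option X) → S.obj Y := fun o => o.elim (g' none) g
  have h1 := congrArg (bind S k) p.2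
  refine Eq.trans (bind_map S some k p.1).symm (h1.trans ((bind_map S (Option.map some) k p.1).trans ?_))
  congr 1
  funext o
  cases o with
  | none => rfl
  | some x => exact h x

/-- The Kleisli extension used in the multiplication of the Trnková closure: on `X` it is the
given map, and the additional point goes to the additional point. -/
def closureMap {X Y : Type u} (f : X → TrnkovaObj S.toFunctor Y) : Option X → S.obj (Option Y) :=
  fun o => o.elim (S.η.app (Option Y) none) (fun x => (f x).1)

/-- Kleisli extension for the Trnková closure of a monad. -/
def closureBind {X Y : Type u} (f : X → TrnkovaObj S.toFunctor Y)
    (p : TrnkovaObj S.toFunctor X) : TrnkovaObj S.toFunctor Y :=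
  ⟨bind S (closureMap S f) p.1, by
    refine (map_bind S _ _ p.1).trans (Eq.trans ?_ (map_bind S _ _ p.1).symm)
    exact bind_congr S p _ _ (fun x => (f x).2)⟩

/-- The unit of the Trnková closure of a monad. -/
def closureUnit {X : Type u} (x : X) : TrnkovaObj S.toFunctor X :=
  trnkovaReflection S.toFunctor X (S.η.app X x)

theorem closureUnit_val {X : Type u} (x : X) :
    (closureUnit S x).1 = S.η.app (Option X) (some x) :=
  map_eta S some x

theorem closureBind_unit {X Y : Type u} (f : X → TrnkovaObj S.toFunctor Y) (x : X) :
    closureBind S f (closureUnit S x) = f x := by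
  refine Subtype.ext ?_
  change bind S (closureMap S f) (closureUnit S x).1 = (f x).1
  rw [closureUnit_val, bind_eta]
  rfl

theorem unit_closureBind {X : Type u} (p : TrnkovaObj S.toFunctor X) :
    closureBind S (closureUnit S) p = p := by
  refine Subtype.ext (eta_bind S _ (fun o => ?_) p.1)
  cases o with
  | none => rfl
  | some x => exact closureUnit_val S x

theorem closureBind_closureBind {X Y Z : Type u} (f : X → TrnkovaObj S.toFunctor Y)
    (g : Y → TrnkovaObj S.toFunctor Z) (p : TrnkovaObj S.toFunctor X) :
    closureBind S g (closureBind S f p) = closureBind S (fun x => closureBind S g (f x)) p := by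
  refine Subtype.ext ((bind_bind S _ _ p.1).trans ?_)
  change bind S _ p.1 = bind S _ p.1
  congr 1
  funext o
  cases o with
  | none => exact bind_eta S _ _
  | some x => rfl

theorem trnkovaMap_eq {X Y : Type u} (f : X → Y) (p : TrnkovaObj S.toFunctor X) :
    trnkovaMap S.toFunctor f p = closureBind S (fun x => closureUnit S (f x)) p := by
  refine Subtype.ext ?_
  change S.map (↾(Option.map f)) p.1 = bind S _ p.1
  have h := bind_map S (Option.map f) (S.η.app (Option Y)) p.1
  rw [eta_bind S _ (fun _ => rfl)] at h
  rw [h]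
  congr 1
  funext o
  cases o with
  | none => rfl
  | some x => exact (closureUnit_val S (f x)).symm

theorem closureBind_map {X Y Z : Type u} (f : X → Y) (g : Y → TrnkovaObj S.toFunctor Z)
    (p : TrnkovaObj S.toFunctor X) :
    closureBind S g (trnkovaMap S.toFunctor f p) = closureBind S (fun x => g (f x)) p := by
  rw [trnkovaMap_eq, closureBind_closureBind]
  exact congrArg (fun k => closureBind S k p) (funext fun x => closureBind_unit S g (f x))

/-- The Trnková closure of a monad on the category of sets. -/
def trnkovaClosure : Monad (Type u) where
  toFunctor := trnkovaFunctor S.toFunctor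
  η :=
    { app := fun X => ↾(closureUnit S : X → TrnkovaObj S.toFunctor X)
      naturality := fun X Y f => by
        ext x
        exact ((trnkovaMap_eq S f _).trans (closureBind_unit S _ x)).symm }
  μ :=
    { app := fun X => ↾(closureBind S id :
        TrnkovaObj S.toFunctor (TrnkovaObj S.toFunctor X) → TrnkovaObj S.toFunctor X)
      naturality := fun X Y f => by
        ext p
        refine (closureBind_map S (trnkovaMap S.toFunctor f) id p).trans ?_
        refine Eq.trans ?_ (trnkovaMap_eq S f (closureBind S id p)).symm
        refine Eq.trans ?_ (closureBind_closureBind S _ _ p).symm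
        exact congrArg (fun k => closureBind S k p) (funext fun q => trnkovaMap_eq S f q) }
  assoc X := by
    ext p
    exact (closureBind_map S (closureBind S id) id p).trans
      (closureBind_closureBind S id id p).symm
  left_unit X := by
    ext p
    exact closureBind_unit S id p
  right_unit X := by
    ext p
    exact (closureBind_map S (closureUnit S) id p).trans (unit_closureBind S p)

/-- The reflection is a monad morphism from `S` to its Trnková closure. -/
def trnkovaReflectionHom : S ⟶ trnkovaClosure S where
  app X := ↾(trnkovaReflection S.toFunctor X)
  naturality X Y f := by
    ext p
    refine Subtype.ext ?_
    exact (map_map S.toFunctor f some p).trans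
      (map_map S.toFunctor some (Option.map f) p).symm
  app_η X := rfl
  app_μ X := by
    ext p
    refine Subtype.ext ?_
    change S.map (↾some) (S.μ.app X p) = bind S (closureMap S id)
      (S.map (↾some) (S.map (↾(trnkovaReflection S.toFunctor X)) p))
    have h1 := bind_map S (trnkovaReflection S.toFunctor X) (closureMap S id ∘ some) p
    rw [bind_map S some (closureMap S id), h1]
    have h2 := map_bind S (id : S.obj X → S.obj X) (some : X → Option X) p
    refine Eq.trans ?_ h2
    exact congrArg (fun q => S.map (↾some) (S.μ.app X q))
      (map_id S.toFunctor id (fun _ => rfl) p).symm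

end

/-- A monad `S` on the category of sets is substantially exceptional when its Trnková closure is
isomorphic, as a monad, to the exception monad `X ↦ E + X` of some set `E`. -/
def IsSubstantiallyExceptional (S : Monad (Type u)) : Prop :=
  ∃ E : Type u, Nonempty (trnkovaClosure S ≅ coprodMonad E)

end SetMonad

/-! A coproduct of monads amounts to free bialgebras: sets with both an `S`-algebra and a
`T`-algebra structure. By consistency variables and non-variables can be separated, and the free
bialgebra on `A` should be `A + X + Y`, with `X` the non-variable `S`-terms over `A + Y` and `Y` the
non-variable `T`-terms over `A + X`, both generated in a well-founded way (`AlternatingTerms`). The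
only obstruction to such a pair is size.

Sufficiency: given any `X`, `Y` into which these sets of terms inject, a least fixed point inside
them gives the alternating terms (`hasBinaryCoproduct_of_injOn`). If `S` is exceptional, its
non-variables inject into a fixed set; a large joint fixpoint `λ` gives `X = Y = λ`.

Necessity: an algebra on `B` induces a morphism to the continuation monad of `B`, so the coproduct
at `A` maps homomorphically to every bialgebra (`exists_isHom_coprod`). Alternating terms are
evaluated in the coproduct. Any `S`-algebra and `T`-algebra with at least two elements embed in one
bialgebra, identified along a given common subset (`exists_amalgam`); mapping to such a bialgebra
shows that evaluation is injective (`exists_alternatingTerms`). If neither monad is exceptional,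
each has at least `|Z|` non-variables over every large `Z` (`exists_injective_nonunits`). For large
`A` this forces `|X| = |Y| = λ ≥ |A|`, and `S(A + Y) ≅ A + X + Y ≅ T(A + X)` makes `λ` a joint
fixpoint. -/

namespace SetMonad

open CategoryTheory CategoryTheory.Limits Cardinal

/-! ### Algebras of a monad on sets -/

/-- `b` is the structure map of an Eilenberg–Moore algebra for `S`. -/
structure IsAlgebra (S : Monad (Type u)) {B : Type u} (b : S.obj B → B) : Prop where
  unit : ∀ x, b (S.η.app B x) = x
  bind : ∀ {X : Type u} (f : X → S.obj B) (p : S.obj X),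
    b (bind S f p) = b (S.map (↾(b ∘ f)) p)

/-- `h` is a homomorphism of `S`-algebras from `b` to `c`. -/
def IsHom (S : Monad (Type u)) {B C : Type u} (b : S.obj B → B) (c : S.obj C → C)
    (h : B → C) : Prop :=
  ∀ p, h (b p) = c (S.map (↾h) p)

section Basic

variable (S : Monad (Type u))

theorem map_congr {X Y : Type u} {f g : X → Y} (h : ∀ x, f x = g x) (p : S.obj X) :
    S.map (↾f) p = S.map (↾g) p := by
  rw [funext h]

/-- An injection with nonempty domain has a left inverse. For empty domain the monad structure is
needed: the Kleisli extension of any constant map `Y → S X` is a left inverse, since all maps out of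
the empty set, including the unit, agree. -/
theorem map_injective {X Y : Type u} {f : X → Y} (hf : Function.Injective f) :
    Function.Injective (S.map (↾f)) := by
  intro p q h
  rcases isEmpty_or_nonempty X with hX | hX
  · have h1 := congrArg (SetMonad.bind S (fun _ : Y => p)) h
    rwa [bind_map, bind_map, eta_bind S _ (fun x => isEmptyElim x),
      eta_bind S _ (fun x => isEmptyElim x)] at h1
  · obtain ⟨g, hg⟩ := hf.hasLeftInverse
    have h1 := congrArg (S.map (↾g)) h
    rwa [map_map, map_map, map_id _ _ hg, map_id _ _ hg] at h1

variable {S}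

/-- Makes "non-variable terms" functorial along injections. For empty `X`, a variable as image would
have equal images under the two constant maps to a two-point set, against consistency. -/
theorem map_notMem_range_eta (hS : IsConsistent S) {X Y : Type u} {f : X → Y}
    (hf : Function.Injective f) {p : S.obj X} (hp : p ∉ Set.range (S.η.app X)) :
    S.map (↾f) p ∉ Set.range (S.η.app Y) := by
  rintro ⟨y, hy⟩
  rcases isEmpty_or_nonempty X with hX | hX
  · have h1 := congrArg (S.map (↾fun _ : Y => ULift.up.{u} true)) hy
    have h2 := congrArg (S.map (↾fun _ : Y => ULift.up.{u} false)) hy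
    rw [map_map, map_eta] at h1 h2
    have h3 : S.η.app (ULift.{u} Bool) (ULift.up true) = S.η.app _ (ULift.up false) := by
      rw [h1, h2]
      exact map_congr S (fun x => isEmptyElim x) p
    have h4 := hS _ h3
    simp at h4
  · obtain ⟨g, hg⟩ := hf.hasLeftInverse
    have h1 := congrArg (S.map (↾g)) hy
    rw [map_map, map_id _ _ hg, map_eta] at h1
    exact hp ⟨_, h1⟩

/-- The algebra structure on `W` transported from the free algebra on `Z`. -/
def transportFree {Z W : Type u} (e : S.obj Z ≃ W) (q : S.obj W) : W :=
  e (bind S e.symm q)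

theorem isAlgebra_transportFree {Z W : Type u} (e : S.obj Z ≃ W) :
    IsAlgebra S (transportFree e) where
  unit x := by
    unfold transportFree
    rw [bind_eta, e.apply_symm_apply]
  bind f p := by
    unfold transportFree
    rw [bind_bind, bind_map]
    congr 2
    funext x
    simp

/-- Homomorphisms out of a free algebra are determined by their values on generators. -/
theorem isHom_transportFree_iff {Z W B : Type u} (e : S.obj Z ≃ W) {b : S.obj B → B}
    (hb : IsAlgebra S b) (h : W → B) :
    IsHom S (transportFree e) b h ↔
      ∀ p, h (e p) = b (S.map (↾fun z => h (e (S.η.app Z z))) p) := by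
  constructor
  · intro hh p
    have h1 := hh (S.map (↾fun z => e (S.η.app Z z)) p)
    unfold transportFree at h1
    rw [bind_map, map_map, eta_bind S _ (fun z => by simp)] at h1
    exact h1
  · intro hh q
    unfold transportFree
    rw [hh, map_bind, hb.bind]
    congr 1
    refine map_congr S (fun w => ?_) q
    change b (S.map _ (e.symm w)) = h w
    rw [← hh, e.apply_symm_apply]

/-- The multiplication of `S` is the structure map of the free algebra on `X`. -/
theorem isAlgebra_bind_id (X : Type u) : IsAlgebra S (fun q : S.obj (S.obj X) => bind S id q) where
  unit x := bind_eta S id x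
  bind f p := by
    rw [bind_bind, bind_map]
    rfl

theorem map_eq_bind {X Y : Type u} (f : X → Y) (p : S.obj X) :
    S.map (↾f) p = bind S (fun x => S.η.app Y (f x)) p := by
  have h := bind_map S f (S.η.app Y) p
  rw [eta_bind S _ (fun _ => rfl)] at h
  exact h

theorem IsHom.apply_free {X B : Type u} {b : S.obj B → B} {h : S.obj X → B}
    (hh : IsHom S (fun q : S.obj (S.obj X) => bind S id q) b h) (p : S.obj X) :
    h p = b (S.map (↾fun x => h (S.η.app X x)) p) := by
  have h1 := hh (S.map (↾(S.η.app X : X → S.obj X)) p)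
  rw [map_map] at h1
  refine Eq.trans (congrArg h ?_) h1
  change p = bind S id (S.map (↾(S.η.app X : X → S.obj X)) p)
  rw [bind_map]
  exact (eta_bind S _ (fun z => rfl) p).symm

end Basic

/-! ### Fixpoints with a well-founded rank -/

/-- In the least fixed point, the rank of `w` is the first stage of the transfinite iteration
containing it. That stage is the union of `Φ` applied to earlier stages, whose elements have smaller
rank. -/
theorem exists_fixpoint_rank {Z : Type u} (Φ : Set Z →o Set Z) :
    ∃ (W : Set Z) (ρ : Z → Ordinal.{u}), Φ W ⊆ W ∧
      ∀ w ∈ W, w ∈ Φ {w' | w' ∈ W ∧ ρ w' < ρ w} := by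
  let stage : Ordinal.{u} → Set Z := OrdinalApprox.lfpApprox Φ ⊥
  obtain ⟨i, hi⟩ := OrdinalApprox.lfp_mem_range_lfpApprox Φ
  have hmem : ∀ (a : Ordinal.{u}) (w : Z), w ∈ stage a → ∃ b < a, w ∈ Φ (stage b) := by
    intro a w hw
    change w ∈ OrdinalApprox.lfpApprox Φ ⊥ a at hw
    rw [OrdinalApprox.lfpApprox] at hw
    simp only [Set.bot_eq_empty, Set.sup_eq_union, Set.empty_union, Set.iSup_eq_iUnion,
      Set.mem_iUnion] at hw
    obtain ⟨b, hb, hw⟩ := hw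
    exact ⟨b, hb, hw⟩
  have hle : ∀ a, stage a ⊆ Φ.lfp := fun a =>
    OrdinalApprox.lfpApprox_le_of_mem_fixedPoints Φ Φ.isFixedPt_lfp bot_le a
  refine ⟨Φ.lfp, fun z => sInf {a | z ∈ stage a}, Φ.map_lfp.le, fun w hw => ?_⟩
  have hne : {a | w ∈ stage a}.Nonempty := ⟨i, by
    change w ∈ OrdinalApprox.lfpApprox Φ ⊥ i
    rw [hi]; exact hw⟩
  obtain ⟨b, hb, hwb⟩ := hmem (sInf {a | w ∈ stage a}) w (csInf_mem (s := {a | w ∈ stage a}) hne)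
  have hsub : stage b ≤ {w' | w' ∈ Φ.lfp ∧ sInf {a | w' ∈ stage a} < sInf {a | w ∈ stage a}} :=
    fun w' hw' => ⟨hle b hw', lt_of_le_of_lt (csInf_le' (s := {a | w' ∈ stage a}) hw') hb⟩
  exact Φ.monotone hsub hwb

/-! ### Alternating terms -/

/-- The subsets `U` and `V` are jointly closed under the operations `s` and `t` applied to elements
that are not variables, and every element arises in this way from elements of smaller rank. -/
structure IsResolved {S T : Monad (Type u)} {A X Y : Type u} (s : S.obj (A ⊕ Y) → X)
    (t : T.obj (A ⊕ X) → Y) (U : Set X) (V : Set Y) (ρ : X ⊕ Y → Ordinal.{u}) : Prop where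
  closed_s : ∀ p : S.obj (A ⊕ V), p ∉ Set.range (S.η.app _) →
    s (S.map (↾(Sum.map id Subtype.val)) p) ∈ U
  closed_t : ∀ p : T.obj (A ⊕ U), p ∉ Set.range (T.η.app _) →
    t (T.map (↾(Sum.map id Subtype.val)) p) ∈ V
  supp_s : ∀ u ∈ U, ∃ p : S.obj (A ⊕ {v : V // ρ (Sum.inr v) < ρ (Sum.inl u)}),
    p ∉ Set.range (S.η.app _) ∧ s (S.map (↾(Sum.map id fun v => v.1.1)) p) = u
  supp_t : ∀ v ∈ V, ∃ p : T.obj (A ⊕ {u : U // ρ (Sum.inl u) < ρ (Sum.inr v)}),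
    p ∉ Set.range (T.η.app _) ∧ t (T.map (↾(Sum.map id fun u => u.1.1)) p) = v

/-- Both closure conditions form one operator on subsets of `X ⊕ Y`; it is monotone because
non-variables remain non-variables under inclusions. -/
theorem exists_isResolved {S T : Monad (Type u)} (hS : IsConsistent S) (hT : IsConsistent T)
    {A X Y : Type u} (s : S.obj (A ⊕ Y) → X) (t : T.obj (A ⊕ X) → Y) :
    ∃ U V ρ, IsResolved s t U V ρ := by
  let Φ : Set (X ⊕ Y) →o Set (X ⊕ Y) :=
    { toFun := fun W => {z |
        (∃ p : S.obj (A ⊕ {y // Sum.inr y ∈ W}), p ∉ Set.range (S.η.app _) ∧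
          Sum.inl (s (S.map (↾(Sum.map id Subtype.val)) p)) = z) ∨
        (∃ p : T.obj (A ⊕ {x // Sum.inl x ∈ W}), p ∉ Set.range (T.η.app _) ∧
          Sum.inr (t (T.map (↾(Sum.map id Subtype.val)) p)) = z)}
      monotone' := by
        rintro W W' hW z (⟨p, hp, rfl⟩ | ⟨p, hp, rfl⟩)
        · refine Or.inl ⟨S.map (↾(Sum.map id fun y => ⟨y.1, hW y.2⟩)) p,
            map_notMem_range_eta hS ?_ hp, ?_⟩
          · exact Sum.map_injective.2 ⟨Function.injective_id, fun y y' h =>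
              Subtype.ext (by simpa using h)⟩
          · rw [map_map]
            congr 2
            exact map_congr S (fun z => by cases z <;> rfl) p
        · refine Or.inr ⟨T.map (↾(Sum.map id fun y => ⟨y.1, hW y.2⟩)) p,
            map_notMem_range_eta hT ?_ hp, ?_⟩
          · exact Sum.map_injective.2 ⟨Function.injective_id, fun y y' h =>
              Subtype.ext (by simpa using h)⟩
          · rw [map_map]
            congr 2
            exact map_congr T (fun z => by cases z <;> rfl) p }
  obtain ⟨W, ρ, hW, hρ⟩ := exists_fixpoint_rank Φ
  refine ⟨{x | Sum.inl x ∈ W}, {y | Sum.inr y ∈ W}, ρ, ?_, ?_, ?_, ?_⟩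
  · exact fun p hp => hW (Or.inl ⟨p, hp, rfl⟩)
  · exact fun p hp => hW (Or.inr ⟨p, hp, rfl⟩)
  · intro u hu
    rcases hρ _ hu with ⟨p, hp, h⟩ | ⟨p, hp, h⟩
    · refine ⟨S.map (↾(Sum.map id fun y => ⟨⟨y.1, y.2.1⟩, y.2.2⟩)) p,
        map_notMem_range_eta hS ?_ hp, ?_⟩
      · exact Sum.map_injective.2 ⟨Function.injective_id, fun y y' h =>
          Subtype.ext (congrArg (fun v => v.1.1) h)⟩
      · rw [map_map]
        refine Eq.trans (congrArg s (map_congr S (fun z => ?_) p)) (Sum.inl_injective h)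
        cases z <;> rfl
    · cases h
  · intro v hv
    rcases hρ _ hv with ⟨p, hp, h⟩ | ⟨p, hp, h⟩
    · cases h
    · refine ⟨T.map (↾(Sum.map id fun y => ⟨⟨y.1, y.2.1⟩, y.2.2⟩)) p,
        map_notMem_range_eta hT ?_ hp, ?_⟩
      · exact Sum.map_injective.2 ⟨Function.injective_id, fun y y' h =>
          Subtype.ext (congrArg (fun v => v.1.1) h)⟩
      · rw [map_map]
        refine Eq.trans (congrArg t (map_congr T (fun z => ?_) p)) (Sum.inr_injective h)
        cases z <;> rfl

/-- A simultaneous description of `A + X + Y` as the free `S`-algebra on `A + Y` and the free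
`T`-algebra on `A + X` that is generated by `A` in a well-founded way. -/
structure AlternatingTerms (S T : Monad (Type u)) (A X Y : Type u) where
  /-- Evaluation of `S`-terms. -/
  s : S.obj (A ⊕ Y) ≃ A ⊕ (X ⊕ Y)
  /-- Evaluation of `T`-terms. -/
  t : T.obj (A ⊕ X) ≃ A ⊕ (X ⊕ Y)
  s_unit : ∀ z, s (S.η.app _ z) = Sum.map id Sum.inr z
  t_unit : ∀ z, t (T.η.app _ z) = Sum.map id Sum.inl z
  /-- The rank of a term. -/
  ρ : X ⊕ Y → Ordinal.{u}
  s_supp : ∀ x, ∃ p : S.obj (A ⊕ {y : Y // ρ (Sum.inr y) < ρ (Sum.inl x)}),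
    s (S.map (↾(Sum.map id Subtype.val)) p) = Sum.inr (Sum.inl x)
  t_supp : ∀ y, ∃ p : T.obj (A ⊕ {x : X // ρ (Sum.inl x) < ρ (Sum.inr y)}),
    t (T.map (↾(Sum.map id Subtype.val)) p) = Sum.inr (Sum.inr y)

/-- Extension of a bijection between non-variables and `X` to all terms. -/
theorem exists_equiv_of_bijOn {S : Monad (Type u)} (hS : IsConsistent S) {Z X : Type u}
    (f : S.obj Z → X → Prop)
    (hf : ∀ p, p ∉ Set.range (S.η.app Z) → ∃ x, f p x)
    (hf' : ∀ x, ∃ p, p ∉ Set.range (S.η.app Z) ∧ f p x)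
    (hinj : ∀ p q x, f p x → f q x → p = q)
    (hfun : ∀ p x y, f p x → f p y → x = y) :
    ∃ e : S.obj Z ≃ Z ⊕ X, (∀ z, e (S.η.app Z z) = Sum.inl z) ∧
      ∀ p x, f p x → e p = Sum.inr x := by
  choose g hg using hf'
  let k : Z ⊕ X → S.obj Z := Sum.elim (S.η.app Z) g
  have hk : Function.Bijective k := by
    constructor
    · rintro (z | x) (z' | x') h
      · exact congrArg Sum.inl (hS Z h)
      · exact absurd ⟨z, h⟩ (hg x').1
      · exact absurd ⟨z', h.symm⟩ (hg x).1
      · refine congrArg Sum.inr (hfun (g x) _ _ (hg x).2 ?_)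
        change g x = g x' at h
        rw [h]; exact (hg x').2
    · intro p
      by_cases hp : p ∈ Set.range (S.η.app Z)
      · obtain ⟨z, rfl⟩ := hp
        exact ⟨Sum.inl z, rfl⟩
      · obtain ⟨x, hx⟩ := hf p hp
        exact ⟨Sum.inr x, hinj _ _ x (hg x).2 hx⟩
  refine ⟨(Equiv.ofBijective k hk).symm, fun z => ?_, fun p x hx => ?_⟩
  · rw [Equiv.symm_apply_eq]; rfl
  · rw [Equiv.symm_apply_eq]; exact (hinj _ _ x (hg x).2 hx).symm

/-- Closure and support make `s` and `t` surjections from non-variables onto `U` and `V`; the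
injectivity assumptions turn them into bijections, to which the variables are added back. -/
theorem IsResolved.nonempty_alternatingTerms {S T : Monad (Type u)} (hS : IsConsistent S)
    (hT : IsConsistent T) {A X Y : Type u} {s : S.obj (A ⊕ Y) → X} {t : T.obj (A ⊕ X) → Y}
    {U : Set X} {V : Set Y} {ρ : X ⊕ Y → Ordinal.{u}} (h : IsResolved s t U V ρ)
    (hs : ∀ p q : S.obj (A ⊕ V), p ∉ Set.range (S.η.app _) → q ∉ Set.range (S.η.app _) →
      s (S.map (↾(Sum.map id Subtype.val)) p) = s (S.map (↾(Sum.map id Subtype.val)) q) → p = q)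
    (ht : ∀ p q : T.obj (A ⊕ U), p ∉ Set.range (T.η.app _) → q ∉ Set.range (T.η.app _) →
      t (T.map (↾(Sum.map id Subtype.val)) p) = t (T.map (↾(Sum.map id Subtype.val)) q) → p = q) :
    Nonempty (AlternatingTerms S T A U V) := by
  have injs : ∀ u : X, Function.Injective
      (Sum.map id Subtype.val : A ⊕ {v : V // ρ (Sum.inr v) < ρ (Sum.inl u)} → A ⊕ V) := fun u =>
    Sum.map_injective.2 ⟨Function.injective_id, Subtype.val_injective⟩
  have injt : ∀ v : Y, Function.Injective
      (Sum.map id Subtype.val : A ⊕ {u : U // ρ (Sum.inl u) < ρ (Sum.inr v)} → A ⊕ U) := fun u =>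
    Sum.map_injective.2 ⟨Function.injective_id, Subtype.val_injective⟩
  have hs_supp : ∀ x : U, ∃ p : S.obj (A ⊕ {v : V // ρ (Sum.inr v) < ρ (Sum.inl x)}),
      S.map (↾(Sum.map id Subtype.val)) p ∉ Set.range (S.η.app (A ⊕ V)) ∧
      s (S.map (↾(Sum.map id Subtype.val)) (S.map (↾(Sum.map id Subtype.val)) p)) = x := by
    intro x
    obtain ⟨p, hp, hpx⟩ := h.supp_s x x.2
    refine ⟨p, map_notMem_range_eta hS (injs _) hp, ?_⟩
    rw [map_map]
    refine Eq.trans (congrArg s (map_congr S (fun z => ?_) p)) hpx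
    cases z <;> rfl
  have ht_supp : ∀ y : V, ∃ p : T.obj (A ⊕ {u : U // ρ (Sum.inl u) < ρ (Sum.inr y)}),
      T.map (↾(Sum.map id Subtype.val)) p ∉ Set.range (T.η.app (A ⊕ U)) ∧
      t (T.map (↾(Sum.map id Subtype.val)) (T.map (↾(Sum.map id Subtype.val)) p)) = y := by
    intro y
    obtain ⟨p, hp, hpy⟩ := h.supp_t y y.2
    refine ⟨p, map_notMem_range_eta hT (injt _) hp, ?_⟩
    rw [map_map]
    refine Eq.trans (congrArg t (map_congr T (fun z => ?_) p)) hpy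
    cases z <;> rfl
  obtain ⟨e, he, he'⟩ := exists_equiv_of_bijOn hS
    (fun (p : S.obj (A ⊕ V)) (x : U) => p ∉ Set.range (S.η.app _) ∧
      s (S.map (↾(Sum.map id Subtype.val)) p) = x)
    (fun p hp => ⟨⟨_, h.closed_s p hp⟩, hp, rfl⟩)
    (fun x => (hs_supp x).elim fun p hp => ⟨_, hp.1, hp.1, hp.2⟩)
    (fun p q x hp hq => hs p q hp.1 hq.1 (hp.2.trans hq.2.symm))
    (fun p x y hx hy => Subtype.ext (hx.2.symm.trans hy.2))
  obtain ⟨d, hd, hd'⟩ := exists_equiv_of_bijOn hT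
    (fun (p : T.obj (A ⊕ U)) (x : V) => p ∉ Set.range (T.η.app _) ∧
      t (T.map (↾(Sum.map id Subtype.val)) p) = x)
    (fun p hp => ⟨⟨_, h.closed_t p hp⟩, hp, rfl⟩)
    (fun x => (ht_supp x).elim fun p hp => ⟨_, hp.1, hp.1, hp.2⟩)
    (fun p q x hp hq => ht p q hp.1 hq.1 (hp.2.trans hq.2.symm))
    (fun p x y hx hy => Subtype.ext (hx.2.symm.trans hy.2))
  let es : (A ⊕ V) ⊕ U ≃ A ⊕ (U ⊕ V) :=
    (Equiv.sumAssoc _ _ _).trans (Equiv.sumCongr (Equiv.refl _) (Equiv.sumComm _ _))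
  let et : (A ⊕ U) ⊕ V ≃ A ⊕ (U ⊕ V) := Equiv.sumAssoc _ _ _
  refine ⟨⟨e.trans es, d.trans et, fun z => ?_, fun z => ?_,
    fun z => ρ (Sum.map Subtype.val Subtype.val z), fun x => ?_, fun y => ?_⟩⟩
  · rw [Equiv.trans_apply, he]
    cases z <;> rfl
  · rw [Equiv.trans_apply, hd]
    cases z <;> rfl
  · obtain ⟨p, hp, hpx⟩ := hs_supp x
    refine ⟨p, ?_⟩
    rw [Equiv.trans_apply]
    exact congrArg es (he' _ x ⟨hp, hpx⟩)
  · obtain ⟨p, hp, hpx⟩ := ht_supp y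
    refine ⟨p, ?_⟩
    rw [Equiv.trans_apply]
    exact congrArg et (hd' _ y ⟨hp, hpx⟩)

/-! ### Free bialgebras -/

/-- A free object on `A` among the sets with an `S`-algebra and a `T`-algebra structure. -/
structure FreeBialgebra (S T : Monad (Type u)) (A : Type u) where
  /-- The underlying set. -/
  carrier : Type u
  /-- The `S`-algebra structure. -/
  s : S.obj carrier → carrier
  /-- The `T`-algebra structure. -/
  t : T.obj carrier → carrier
  isAlgebra_s : IsAlgebra S s
  isAlgebra_t : IsAlgebra T t
  /-- The inclusion of the generators. -/
  ι : A → carrier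
  existsUnique_lift : ∀ {B : Type u} {b : S.obj B → B} {c : T.obj B → B}, IsAlgebra S b →
    IsAlgebra T c → ∀ f : A → B,
      ∃! h : carrier → B, (∀ a, h (ι a) = f a) ∧ IsHom S s b h ∧ IsHom T t c h

namespace AlternatingTerms

variable {S T : Monad (Type u)} {A X Y : Type u} (D : AlternatingTerms S T A X Y)

/-- The extension of `f` to all terms, by recursion on the rank. -/
noncomputable def eval {B : Type u} (b : S.obj B → B) (c : T.obj B → B) (f : A → B) :
    X ⊕ Y → B :=
  (InvImage.wf D.ρ Ordinal.lt_wf).fix fun z ih =>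
    match z, ih with
    | Sum.inl x, ih => b (S.map (↾(Sum.elim f fun y => ih (Sum.inr y.1) y.2))
        (Classical.choose (D.s_supp x)))
    | Sum.inr y, ih => c (T.map (↾(Sum.elim f fun x => ih (Sum.inl x.1) x.2))
        (Classical.choose (D.t_supp y)))

theorem eval_inl {B : Type u} (b : S.obj B → B) (c : T.obj B → B) (f : A → B) (x : X) :
    D.eval b c f (Sum.inl x) = b (S.map (↾(Sum.elim f fun y => D.eval b c f (Sum.inr y.1)))
      (Classical.choose (D.s_supp x))) :=
  WellFounded.fix_eq _ _ _

theorem eval_inr {B : Type u} (b : S.obj B → B) (c : T.obj B → B) (f : A → B) (y : Y) :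
    D.eval b c f (Sum.inr y) = c (T.map (↾(Sum.elim f fun x => D.eval b c f (Sum.inl x.1)))
      (Classical.choose (D.t_supp y))) :=
  WellFounded.fix_eq _ _ _

theorem isHom_elim_eval {B : Type u} {b : S.obj B → B} {c : T.obj B → B} (hb : IsAlgebra S b)
    (hc : IsAlgebra T c) (f : A → B) :
    IsHom S (transportFree D.s) b (Sum.elim f (D.eval b c f)) ∧
      IsHom T (transportFree D.t) c (Sum.elim f (D.eval b c f)) := by
  rw [isHom_transportFree_iff D.s hb, isHom_transportFree_iff D.t hc]
  constructor
  · intro p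
    rcases hp : D.s p with a | x | y
    · obtain rfl : p = S.η.app _ (Sum.inl a) := by
        rw [← D.s.injective.eq_iff, hp, D.s_unit]; rfl
      refine Eq.trans ?_ (congrArg b (map_eta S _ (Sum.inl a))).symm
      rw [hb.unit, hp]
    · obtain rfl : S.map (↾(Sum.map id Subtype.val)) (Classical.choose (D.s_supp x)) = p := by
        rw [← D.s.injective.eq_iff, hp]
        exact Classical.choose_spec (D.s_supp x)
      rw [map_map, Sum.elim_inr, eval_inl]
      congr 1
      refine map_congr S (fun z => ?_) _
      rw [Function.comp_apply, D.s_unit]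
      cases z <;> rfl
    · obtain rfl : p = S.η.app _ (Sum.inr y) := by
        rw [← D.s.injective.eq_iff, hp, D.s_unit]; rfl
      refine Eq.trans ?_ (congrArg b (map_eta S _ (Sum.inr y))).symm
      rw [hb.unit, hp]
  · intro p
    rcases hp : D.t p with a | x | y
    · obtain rfl : p = T.η.app _ (Sum.inl a) := by
        rw [← D.t.injective.eq_iff, hp, D.t_unit]; rfl
      refine Eq.trans ?_ (congrArg c (map_eta T _ (Sum.inl a))).symm
      rw [hc.unit, hp]
    · obtain rfl : p = T.η.app _ (Sum.inr x) := by
        rw [← D.t.injective.eq_iff, hp, D.t_unit]; rfl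
      refine Eq.trans ?_ (congrArg c (map_eta T _ (Sum.inr x))).symm
      rw [hc.unit, hp]
    · obtain rfl : T.map (↾(Sum.map id Subtype.val)) (Classical.choose (D.t_supp y)) = p := by
        rw [← D.t.injective.eq_iff, hp]
        exact Classical.choose_spec (D.t_supp y)
      rw [map_map, Sum.elim_inr, eval_inr]
      congr 1
      refine map_congr T (fun z => ?_) _
      rw [Function.comp_apply, D.t_unit]
      cases z <;> rfl

theorem hom_ext {B : Type u} {b : S.obj B → B} {c : T.obj B → B} (hb : IsAlgebra S b)
    (hc : IsAlgebra T c) {h k : A ⊕ (X ⊕ Y) → B} (hk : ∀ a, h (Sum.inl a) = k (Sum.inl a))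
    (hs : IsHom S (transportFree D.s) b h) (ht : IsHom T (transportFree D.t) c h)
    (ks : IsHom S (transportFree D.s) b k) (kt : IsHom T (transportFree D.t) c k) : h = k := by
  rw [isHom_transportFree_iff D.s hb] at hs ks
  rw [isHom_transportFree_iff D.t hc] at ht kt
  have key : ∀ z : X ⊕ Y, h (Sum.inr z) = k (Sum.inr z) := by
    intro z
    induction z using (InvImage.wf D.ρ Ordinal.lt_wf).induction with
    | _ z ih =>
      rcases z with x | y
      · obtain ⟨p, hp⟩ := D.s_supp x
        rw [← hp, hs, ks, map_map, map_map]
        congr 1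
        refine map_congr S (fun z => ?_) _
        simp only [Function.comp_apply, D.s_unit]
        rcases z with a | y
        · exact hk a
        · exact ih _ y.2
      · obtain ⟨p, hp⟩ := D.t_supp y
        rw [← hp, ht, kt, map_map, map_map]
        congr 1
        refine map_congr T (fun z => ?_) _
        simp only [Function.comp_apply, D.t_unit]
        rcases z with a | x
        · exact hk a
        · exact ih _ x.2
  funext z
  rcases z with a | z
  · exact hk a
  · exact key z

/-- The set of terms is a free bialgebra. -/
def freeBialgebra : FreeBialgebra S T A where
  carrier := A ⊕ (X ⊕ Y)
  s := transportFree D.s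
  t := transportFree D.t
  isAlgebra_s := isAlgebra_transportFree D.s
  isAlgebra_t := isAlgebra_transportFree D.t
  ι := Sum.inl
  existsUnique_lift hb hc f :=
    ⟨Sum.elim f (D.eval _ _ f), ⟨fun _ => rfl, D.isHom_elim_eval hb hc f⟩, fun _ hh =>
      D.hom_ext hb hc hh.1 hh.2.1 hh.2.2 (D.isHom_elim_eval hb hc f).1
        (D.isHom_elim_eval hb hc f).2⟩

end AlternatingTerms

/-! ### The coproduct of two monads from free bialgebras -/

theorem IsHom.id {S : Monad (Type u)} {B : Type u} (b : S.obj B → B) : IsHom S b b id := fun p =>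
  congrArg b (map_id S.toFunctor _root_.id (fun _ => rfl) p).symm

theorem IsHom.comp {S : Monad (Type u)} {B C D : Type u} {b : S.obj B → B} {c : S.obj C → C}
    {d : S.obj D → D} {k : C → D} {h : B → C} (hk : IsHom S c d k) (hh : IsHom S b c h) :
    IsHom S b d (k ∘ h) := fun p => by
  rw [Function.comp_apply, hh, hk, map_map]

theorem IsAlgebra.mu {S : Monad (Type u)} {B : Type u} {b : S.obj B → B} (hb : IsAlgebra S b)
    (q : S.obj (S.obj B)) : b (S.μ.app B q) = b (S.map (↾b) q) := by
  have h := hb.bind id q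
  unfold SetMonad.bind at h
  rw [show S.map (↾(_root_.id : S.obj B → S.obj B)) q = q from
    map_id S.toFunctor _ (fun _ => rfl) q] at h
  exact h

namespace FreeBialgebra

variable {S T : Monad (Type u)} {A : Type u} (F : FreeBialgebra S T A)

section

variable {B : Type u} {b : S.obj B → B} {c : T.obj B → B} (hb : IsAlgebra S b)
  (hc : IsAlgebra T c) (f : A → B)

/-- The homomorphic extension of a map on generators. -/
noncomputable def lift : F.carrier → B := Classical.choose (F.existsUnique_lift hb hc f)

theorem lift_ι (a : A) : F.lift hb hc f (F.ι a) = f a :=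
  (Classical.choose_spec (F.existsUnique_lift hb hc f)).1.1 a

theorem isHom_lift_s : IsHom S F.s b (F.lift hb hc f) :=
  (Classical.choose_spec (F.existsUnique_lift hb hc f)).1.2.1

theorem isHom_lift_t : IsHom T F.t c (F.lift hb hc f) :=
  (Classical.choose_spec (F.existsUnique_lift hb hc f)).1.2.2

include hb hc in
theorem hom_ext {h k : F.carrier → B} (hk : ∀ a, h (F.ι a) = k (F.ι a)) (hs : IsHom S F.s b h)
    (ht : IsHom T F.t c h) (ks : IsHom S F.s b k) (kt : IsHom T F.t c k) : h = k :=
  (F.existsUnique_lift hb hc fun a => k (F.ι a)).unique ⟨hk, hs, ht⟩ ⟨fun _ => rfl, ks, kt⟩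

end

end FreeBialgebra

section Coproduct

variable {S T : Monad (Type u)} (F : ∀ A : Type u, FreeBialgebra S T A)

/-- The homomorphic extension of a map between free bialgebras. -/
noncomputable def freeExt {A B : Type u} (f : A → (F B).carrier) : (F A).carrier → (F B).carrier :=
  (F A).lift (F B).isAlgebra_s (F B).isAlgebra_t f

theorem freeExt_ι {A B : Type u} (f : A → (F B).carrier) (a : A) :
    freeExt F f ((F A).ι a) = f a :=
  (F A).lift_ι _ _ _ _

theorem isHom_freeExt_s {A B : Type u} (f : A → (F B).carrier) :
    IsHom S (F A).s (F B).s (freeExt F f) :=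
  (F A).isHom_lift_s _ _ _

theorem isHom_freeExt_t {A B : Type u} (f : A → (F B).carrier) :
    IsHom T (F A).t (F B).t (freeExt F f) :=
  (F A).isHom_lift_t _ _ _

theorem freeExt_self {A : Type u} (f : A → (F A).carrier) (hf : ∀ a, f a = (F A).ι a) :
    freeExt F f = id :=
  (F A).hom_ext (F A).isAlgebra_s (F A).isAlgebra_t (fun a => (freeExt_ι F f a).trans (hf a))
    (isHom_freeExt_s F f) (isHom_freeExt_t F f) (IsHom.id _) (IsHom.id _)

theorem freeExt_comp {A B C : Type u} (f : A → (F B).carrier) (g : B → (F C).carrier) :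
    freeExt F g ∘ freeExt F f = freeExt F (fun a => freeExt F g (f a)) :=
  (F A).hom_ext (F C).isAlgebra_s (F C).isAlgebra_t
    (fun a => by rw [Function.comp_apply, freeExt_ι, freeExt_ι])
    ((isHom_freeExt_s F g).comp (isHom_freeExt_s F f))
    ((isHom_freeExt_t F g).comp (isHom_freeExt_t F f))
    (isHom_freeExt_s F _) (isHom_freeExt_t F _)

theorem freeExt_freeExt {A B C : Type u} (f : A → (F B).carrier) (g : B → (F C).carrier) (p) :
    freeExt F g (freeExt F f p) = freeExt F (fun a => freeExt F g (f a)) p :=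
  congrFun (freeExt_comp F f g) p

/-- The monad of free bialgebras. -/
noncomputable def bialgebraMonad : Monad (Type u) where
  obj A := (F A).carrier
  map {A B} f := ↾(freeExt F fun a => (F B).ι (f a))
  map_id A := by
    ext p
    exact congrFun (freeExt_self F _ fun _ => rfl) p
  map_comp f g := by
    ext p
    refine Eq.trans ?_ (freeExt_freeExt F _ _ p).symm
    exact congrArg (fun k => freeExt F k p) (funext fun a =>
      (freeExt_ι F (fun b => (F _).ι (g b)) (f a)).symm)
  η :=
    { app := fun A => ↾(F A).ι
      naturality := fun A B f => by
        ext a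
        exact (freeExt_ι F _ a).symm }
  μ :=
    { app := fun A => ↾(freeExt F (id : (F A).carrier → (F A).carrier))
      naturality := fun A B f => by
        ext p
        refine (freeExt_freeExt F _ _ p).trans (Eq.trans ?_ (freeExt_freeExt F _ _ p).symm)
        exact congrArg (fun k => freeExt F k p) (funext fun a => freeExt_ι F _ _) }
  assoc A := by
    ext p
    refine (freeExt_freeExt F _ _ p).trans (Eq.trans ?_ (freeExt_freeExt F _ _ p).symm)
    exact congrArg (fun k => freeExt F k p) (funext fun a => freeExt_ι F _ _)
  left_unit A := by
    ext p
    exact freeExt_ι F _ p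
  right_unit A := by
    ext p
    refine (freeExt_freeExt F _ _ p).trans ?_
    exact congrFun (freeExt_self F _ fun a => freeExt_ι F id ((F A).ι a)) p

/-- The monad morphism to the monad of free bialgebras given by a family of algebra structures for
which the maps `freeExt` are homomorphisms. -/
noncomputable def toBialgebraMonad {R : Monad (Type u)}
    (r : ∀ A : Type u, R.obj (F A).carrier → (F A).carrier) (hr : ∀ A, IsAlgebra R (r A))
    (hext : ∀ {A B : Type u} (f : A → (F B).carrier), IsHom R (r A) (r B) (freeExt F f)) :
    R ⟶ bialgebraMonad F where
  app A := ↾fun p : R.obj A => r A (R.map (↾(F A).ι) p)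
  naturality A B f := by
    ext p
    change r B (R.map (↾(F B).ι) (R.map (↾f) p)) = freeExt F _ (r A (R.map (↾(F A).ι) p))
    rw [hext, map_map, map_map]
    congr 1
    exact map_congr R (fun a => (freeExt_ι F _ _).symm) p
  app_η A := by
    ext a
    change r A (R.map (↾(F A).ι) (R.η.app A a)) = (F A).ι a
    rw [map_eta, (hr A).unit]
  app_μ A := by
    ext p
    change r A (R.map (↾(F A).ι) (R.μ.app A p)) = freeExt F id (r (F A).carrier (R.map (↾(F _).ι)
      (R.map (↾fun q : R.obj A => r A (R.map (↾(F A).ι) q)) p)))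
    rw [hext, map_map, map_map]
    have h1 := map_bind R (id : R.obj A → R.obj A) (F A).ι p
    unfold bind at h1
    rw [show R.map (↾(id : R.obj A → R.obj A)) p = p from
      map_id R.toFunctor _ (fun _ => rfl) p] at h1
    rw [h1, (hr A).mu, map_map]
    congr 1
    exact map_congr R (fun a => (freeExt_ι F id _).symm) p

/-- The first coproduct injection. -/
noncomputable def bialgebraInl : S ⟶ bialgebraMonad F :=
  toBialgebraMonad F (fun A => (F A).s) (fun A => (F A).isAlgebra_s) (isHom_freeExt_s F)

/-- The second coproduct injection. -/
noncomputable def bialgebraInr : T ⟶ bialgebraMonad F :=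
  toBialgebraMonad F (fun A => (F A).t) (fun A => (F A).isAlgebra_t) (isHom_freeExt_t F)

end Coproduct

/-! ### Monad morphisms as algebra structures -/

section Hom

variable {S R : Monad (Type u)} (σ : S ⟶ R)

theorem hom_map {X Y : Type u} (f : X → Y) (p : S.obj X) :
    σ.app Y (S.map (↾f) p) = R.map (↾f) (σ.app X p) :=
  ConcreteCategory.congr_hom (σ.naturality (↾f)) p

theorem hom_eta {X : Type u} (x : X) : σ.app X (S.η.app X x) = R.η.app X x :=
  ConcreteCategory.congr_hom (σ.app_η X) x

theorem hom_bind {X Y : Type u} (f : X → S.obj Y) (p : S.obj X) :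
    σ.app Y (bind S f p) = bind R (fun x => σ.app Y (f x)) (σ.app X p) := by
  unfold bind
  refine (ConcreteCategory.congr_hom (σ.app_μ Y) (S.map (↾f) p)).trans (congrArg (R.μ.app Y) ?_)
  change σ.app (R.obj Y) (S.map (↾(σ.app Y : S.obj Y → R.obj Y)) (S.map (↾f) p)) = _
  rw [map_map, hom_map]

/-- The `S`-algebra structure on `R X` induced by a monad morphism from `S` to `R`. -/
def inducedAlgebra (X : Type u) (p : S.obj (R.obj X)) : R.obj X :=
  bind R id (σ.app (R.obj X) p)

theorem isAlgebra_inducedAlgebra (X : Type u) : IsAlgebra S (inducedAlgebra σ X) where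
  unit x := by
    unfold inducedAlgebra
    rw [hom_eta, bind_eta]
    rfl
  bind f p := by
    unfold inducedAlgebra
    rw [hom_bind, hom_map, bind_bind, bind_map]
    rfl

theorem isHom_inducedAlgebra_bind {X Y : Type u} (f : X → R.obj Y) :
    IsHom S (inducedAlgebra σ X) (inducedAlgebra σ Y) (bind R f) := fun p => by
  unfold inducedAlgebra
  rw [bind_bind, hom_map, bind_map]
  rfl

/-- Monad morphisms are homomorphisms between the induced algebras. -/
theorem isHom_inducedAlgebra_comp {Q : Monad (Type u)} (θ : R ⟶ Q) (X : Type u) :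
    IsHom S (inducedAlgebra σ X) (inducedAlgebra (σ ≫ θ) X) (θ.app X) := fun p => by
  unfold inducedAlgebra
  rw [hom_bind, hom_map]
  change _ = bind Q id (Q.map (↾(θ.app X : R.obj X → Q.obj X)) (θ.app (R.obj X) (σ.app (R.obj X) p)))
  rw [bind_map]
  rfl

end Hom

/-! ### Universal property of the monad of free bialgebras. -/

section Coproduct

variable {S T : Monad (Type u)} (F : ∀ A : Type u, FreeBialgebra S T A)

theorem bind_bialgebraMonad {A B : Type u} (f : A → (F B).carrier) (p : (F A).carrier) :
    bind (bialgebraMonad F) f p = freeExt F f p := by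
  refine (freeExt_freeExt F _ _ p).trans ?_
  exact congrArg (fun k => freeExt F k p) (funext fun a => freeExt_ι F _ _)

/-- Needed for uniqueness: a morphism out of the bialgebra monad is then a homomorphism for the
original structures. -/
theorem inducedAlgebra_toBialgebraMonad {R : Monad (Type u)}
    (r : ∀ A : Type u, R.obj (F A).carrier → (F A).carrier) (hr : ∀ A, IsAlgebra R (r A))
    (hext : ∀ {A B : Type u} (f : A → (F B).carrier), IsHom R (r A) (r B) (freeExt F f))
    (A : Type u) : inducedAlgebra (toBialgebraMonad F r hr hext) A = r A := by
  funext p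
  change R.obj (F A).carrier at p
  refine (bind_bialgebraMonad F id _).trans ?_
  change freeExt F id (r _ (R.map (↾(F (F A).carrier).ι) p)) = r A p
  rw [hext, map_map, show R.map (↾(freeExt F id ∘ (F (F A).carrier).ι)) p = p from
    map_id R.toFunctor _ (fun a => freeExt_ι F _ a) p]

/-- The universal morphism out of the monad of free bialgebras. -/
noncomputable def bialgebraDesc {R : Monad (Type u)} (σ : S ⟶ R) (τ : T ⟶ R) :
    bialgebraMonad F ⟶ R where
  app A := ↾((F A).lift (isAlgebra_inducedAlgebra σ A) (isAlgebra_inducedAlgebra τ A) (R.η.app A))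
  naturality A B f := by
    ext p
    have h := (F A).hom_ext (isAlgebra_inducedAlgebra σ B) (isAlgebra_inducedAlgebra τ B)
      (h := (F B).lift (isAlgebra_inducedAlgebra σ B) (isAlgebra_inducedAlgebra τ B) (R.η.app B) ∘
        freeExt F (fun a => (F B).ι (f a)))
      (k := bind R (fun a => R.η.app B (f a)) ∘
        (F A).lift (isAlgebra_inducedAlgebra σ A) (isAlgebra_inducedAlgebra τ A) (R.η.app A))
      (fun a => by simp only [Function.comp_apply, freeExt_ι, FreeBialgebra.lift_ι, bind_eta])
      (((F B).isHom_lift_s _ _ _).comp (isHom_freeExt_s F _))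
      (((F B).isHom_lift_t _ _ _).comp (isHom_freeExt_t F _))
      ((isHom_inducedAlgebra_bind σ _).comp ((F A).isHom_lift_s _ _ _))
      ((isHom_inducedAlgebra_bind τ _).comp ((F A).isHom_lift_t _ _ _))
    exact (congrFun h p).trans (map_eq_bind (S := R) f _).symm
  app_η A := by
    ext a
    exact (F A).lift_ι (isAlgebra_inducedAlgebra σ A) (isAlgebra_inducedAlgebra τ A) _ a
  app_μ A := by
    ext p
    let L := fun A => (F A).lift (isAlgebra_inducedAlgebra σ A) (isAlgebra_inducedAlgebra τ A)
      (R.η.app A)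
    have h := (F (F A).carrier).hom_ext (isAlgebra_inducedAlgebra σ A)
      (isAlgebra_inducedAlgebra τ A) (h := L A ∘ freeExt F id)
      (k := bind R (L A) ∘ L (F A).carrier)
      (fun a => by simp only [L, Function.comp_apply, freeExt_ι, FreeBialgebra.lift_ι, bind_eta]; rfl)
      (((F A).isHom_lift_s _ _ _).comp (isHom_freeExt_s F _))
      (((F A).isHom_lift_t _ _ _).comp (isHom_freeExt_t F _))
      ((isHom_inducedAlgebra_bind σ _).comp ((F _).isHom_lift_s _ _ _))
      ((isHom_inducedAlgebra_bind τ _).comp ((F _).isHom_lift_t _ _ _))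
    refine (congrFun h p).trans ?_
    -- Naturality of `L` along `L A`, again by agreement of two bialgebra homomorphisms on
    -- generators.
    have h2 := (F (F A).carrier).hom_ext (isAlgebra_inducedAlgebra σ (R.obj A))
      (isAlgebra_inducedAlgebra τ (R.obj A)) (h := L (R.obj A) ∘ freeExt F fun a => (F _).ι (L A a))
      (k := bind R (fun a => R.η.app _ (L A a)) ∘ L (F A).carrier)
      (fun a => by simp only [L, Function.comp_apply, freeExt_ι, FreeBialgebra.lift_ι, bind_eta])
      (((F _).isHom_lift_s _ _ _).comp (isHom_freeExt_s F _))
      (((F _).isHom_lift_t _ _ _).comp (isHom_freeExt_t F _))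
      ((isHom_inducedAlgebra_bind σ _).comp ((F _).isHom_lift_s _ _ _))
      ((isHom_inducedAlgebra_bind τ _).comp ((F _).isHom_lift_t _ _ _))
    refine Eq.trans ?_ (congrArg (R.μ.app A) (congrFun h2 p)).symm
    exact congrArg (R.μ.app A) (map_eq_bind (L A) (L (F A).carrier p))

theorem bialgebraInl_desc {R : Monad (Type u)} (σ : S ⟶ R) (τ : T ⟶ R) :
    bialgebraInl F ≫ bialgebraDesc F σ τ = σ := by
  ext A p
  change (F A).lift (isAlgebra_inducedAlgebra σ A) (isAlgebra_inducedAlgebra τ A) (R.η.app A)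
    ((F A).s (S.map (↾(F A).ι) p)) = σ.app A p
  rw [(F A).isHom_lift_s, map_map]
  unfold inducedAlgebra
  rw [hom_map, bind_map]
  exact eta_bind _ _ (fun a => (F A).lift_ι (isAlgebra_inducedAlgebra σ A)
    (isAlgebra_inducedAlgebra τ A) _ a) _

theorem bialgebraInr_desc {R : Monad (Type u)} (σ : S ⟶ R) (τ : T ⟶ R) :
    bialgebraInr F ≫ bialgebraDesc F σ τ = τ := by
  ext A p
  change (F A).lift (isAlgebra_inducedAlgebra σ A) (isAlgebra_inducedAlgebra τ A) (R.η.app A)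
    ((F A).t (T.map (↾(F A).ι) p)) = τ.app A p
  rw [(F A).isHom_lift_t, map_map]
  unfold inducedAlgebra
  rw [hom_map, bind_map]
  exact eta_bind _ _ (fun a => (F A).lift_ι (isAlgebra_inducedAlgebra σ A)
    (isAlgebra_inducedAlgebra τ A) _ a) _

theorem bialgebraDesc_unique {R : Monad (Type u)} (m : bialgebraMonad F ⟶ R) :
    m = bialgebraDesc F (bialgebraInl F ≫ m) (bialgebraInr F ≫ m) := by
  have hs := fun A => isHom_inducedAlgebra_comp (bialgebraInl F) m A
  have ht := fun A => isHom_inducedAlgebra_comp (bialgebraInr F) m A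
  ext A p
  have h := (F A).hom_ext (isAlgebra_inducedAlgebra (bialgebraInl F ≫ m) A)
    (isAlgebra_inducedAlgebra (bialgebraInr F ≫ m) A) (h := m.app A)
    (k := (F A).lift (isAlgebra_inducedAlgebra (bialgebraInl F ≫ m) A)
      (isAlgebra_inducedAlgebra (bialgebraInr F ≫ m) A) (R.η.app A))
    (fun a => (hom_eta m a).trans ((F A).lift_ι _ _ _ a).symm)
    (by
      have h := hs A
      rwa [show inducedAlgebra (bialgebraInl F) A = (F A).s from
        inducedAlgebra_toBialgebraMonad F _ _ _ A] at h)
    (by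
      have h := ht A
      rwa [show inducedAlgebra (bialgebraInr F) A = (F A).t from
        inducedAlgebra_toBialgebraMonad F _ _ _ A] at h)
    ((F A).isHom_lift_s _ _ _) ((F A).isHom_lift_t _ _ _)
  exact congrFun h p

/-- The monad of free bialgebras is the coproduct. -/
theorem hasBinaryCoproduct_of_freeBialgebra (F : ∀ A : Type u, FreeBialgebra S T A) :
    HasBinaryCoproduct S T :=
  HasColimit.mk ⟨BinaryCofan.mk (bialgebraInl F) (bialgebraInr F),
    BinaryCofan.isColimitMk (fun s => bialgebraDesc F s.inl s.inr)
      (fun s => bialgebraInl_desc F s.inl s.inr) (fun s => bialgebraInr_desc F s.inl s.inr)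
      (fun s m hl hr => by rw [← hl, ← hr]; exact bialgebraDesc_unique F m)⟩

end Coproduct

/-- The coproduct exists when there are sets of terms bounding the initial ones. -/
theorem hasBinaryCoproduct_of_injOn {S T : Monad (Type u)} (hS : IsConsistent S)
    (hT : IsConsistent T)
    (H : ∀ A : Type u, ∃ (X Y : Type u) (s : S.obj (A ⊕ Y) → X) (t : T.obj (A ⊕ X) → Y),
      Set.InjOn s (Set.range (S.η.app (A ⊕ Y)))ᶜ ∧ Set.InjOn t (Set.range (T.η.app (A ⊕ X)))ᶜ) :
    HasBinaryCoproduct S T := by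
  refine hasBinaryCoproduct_of_freeBialgebra fun A => Classical.choice ?_
  obtain ⟨X, Y, s, t, hs, ht⟩ := H A
  obtain ⟨U, V, ρ, h⟩ := exists_isResolved hS hT s t
  have hi : ∀ {Z : Type u} (W : Set Z), Function.Injective
      (Sum.map id Subtype.val : A ⊕ W → A ⊕ Z) := fun W =>
    Sum.map_injective.2 ⟨Function.injective_id, Subtype.val_injective⟩
  obtain ⟨D⟩ := h.nonempty_alternatingTerms hS hT
    (fun p q hp hq hpq => map_injective S (hi V) (hs (map_notMem_range_eta hS (hi V) hp)
      (map_notMem_range_eta hS (hi V) hq) hpq))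
    (fun p q hp hq hpq => map_injective T (hi U) (ht (map_notMem_range_eta hT (hi U) hp)
      (map_notMem_range_eta hT (hi U) hq) hpq))
  exact ⟨D.freeBialgebra⟩

/-! ### The continuation monad -/

/-- The continuation monad `X ↦ (X → B) → B`. -/
def contMonad (B : Type u) : Monad (Type u) where
  obj X := (X → B) → B
  map f := ↾fun φ k => φ (fun x => k (f x))
  η := { app := fun _ => ↾fun x k => k x }
  μ := { app := fun _ => ↾fun Φ k => Φ (fun φ => φ k) }

theorem bind_contMonad {B X Y : Type u} (f : X → (contMonad B).obj Y)
    (φ : (contMonad B).obj X) (k : Y → B) : bind (contMonad B) f φ k = φ fun x => f x k :=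
  rfl

variable {S T : Monad (Type u)}

/-- The monad morphism to a continuation monad given by an algebra. -/
def IsAlgebra.toContMonad {B : Type u} {b : S.obj B → B} (hb : IsAlgebra S b) :
    S ⟶ contMonad B where
  app X := ↾fun p k => b (S.map (↾k) p)
  naturality X Y f := by
    ext p
    funext k
    exact congrArg b (map_map S.toFunctor f k p)
  app_η X := by
    ext x
    funext k
    exact (congrArg b (map_eta S k x)).trans (hb.unit _)
  app_μ X := by
    ext q
    funext k
    have h1 : S.map (↾k) (S.μ.app X q) = SetMonad.bind S (fun p => S.map (↾k) p) q := by
      refine Eq.trans ?_ (map_bind S (id : S.obj X → S.obj X) k q)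
      unfold SetMonad.bind
      rw [show S.map (↾(id : S.obj X → S.obj X)) q = q from
        map_id S.toFunctor _ (fun _ => rfl) q]
    refine (congrArg b h1).trans ((hb.bind _ q).trans (congrArg b ?_))
    exact (map_map S.toFunctor (fun (p : S.obj X) (k : X → B) => b (S.map (↾k) p))
      (fun φ => φ k) q).symm

/-- Kleisli extension in the continuation monad is evaluation at a continuation, so fixing the
continuation `f` turns `θ` into an algebra homomorphism. -/
theorem isHom_contMonad {R : Monad (Type u)} (σ : S ⟶ R) {B : Type u} {b : S.obj B → B}
    (hb : IsAlgebra S b) (θ : R ⟶ contMonad B) (h : σ ≫ θ = hb.toContMonad) {A : Type u}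
    (f : A → B) :
    IsHom S (inducedAlgebra σ A) b (fun r => (θ.app A r : (A → B) → B) f) := fun q => by
  unfold inducedAlgebra
  have h1 := congrFun (hom_bind θ (id : R.obj A → R.obj A) (σ.app (R.obj A) q)) f
  refine h1.trans ((bind_contMonad _ _ _).trans ?_)
  have h2 : θ.app (R.obj A) (σ.app (R.obj A) q) = hb.toContMonad.app (R.obj A) q := by
    rw [← h]; rfl
  rw [h2]
  rfl

/-- A coproduct of monads maps, over generators, to all bialgebras. -/
theorem exists_isHom_coprod [HasBinaryCoproduct S T] {B : Type u} {b : S.obj B → B}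
    {c : T.obj B → B} (hb : IsAlgebra S b) (hc : IsAlgebra T c) {A : Type u} (f : A → B) :
    ∃ h : (S ⨿ T).obj A → B, (∀ a, h ((S ⨿ T).η.app A a) = f a) ∧
      IsHom S (inducedAlgebra coprod.inl A) b h ∧ IsHom T (inducedAlgebra coprod.inr A) c h := by
  let θ : S ⨿ T ⟶ contMonad B := coprod.desc hb.toContMonad hc.toContMonad
  refine ⟨fun r => (θ.app A r : (A → B) → B) f, fun a => congrFun (hom_eta θ a) f,
    isHom_contMonad _ hb θ (coprod.inl_desc _ _) f, isHom_contMonad _ hc θ (coprod.inr_desc _ _) f⟩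

/-! ### Amalgamation of an `S`-algebra and a `T`-algebra -/

/-- Powers of algebras. -/
def powAlgebra (J : Type u) {M : Type u} (b : S.obj M → M) (q : S.obj (J → M)) : J → M :=
  fun j => b (S.map (↾fun g : J → M => g j) q)

theorem IsAlgebra.powAlgebra (J : Type u) {M : Type u} {b : S.obj M → M} (hb : IsAlgebra S b) :
    IsAlgebra S (powAlgebra J b) where
  unit x := by
    funext j
    unfold SetMonad.powAlgebra
    rw [map_eta, hb.unit]
  bind f p := by
    funext j
    unfold SetMonad.powAlgebra
    rw [map_bind, hb.bind, map_map]

theorem isHom_const (J : Type u) {M : Type u} (b : S.obj M → M) :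
    IsHom S b (powAlgebra J b) (fun x _ => x) := fun p => by
  funext j
  unfold powAlgebra
  rw [map_map, show S.map (↾((fun g : J → M => g j) ∘ fun x _ => x)) p = p from
    map_id S.toFunctor _ (fun _ => rfl) p]

/-- Transport of an algebra along a bijection. -/
def equivAlgebra {M N : Type u} (e : M ≃ N) (c : S.obj N → N) (q : S.obj M) : M :=
  e.symm (c (S.map (↾e) q))

theorem IsAlgebra.equivAlgebra {M N : Type u} (e : M ≃ N) {c : S.obj N → N} (hc : IsAlgebra S c) :
    IsAlgebra S (equivAlgebra e c) where
  unit x := by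
    unfold SetMonad.equivAlgebra
    rw [map_eta, hc.unit, e.symm_apply_apply]
  bind f p := by
    unfold SetMonad.equivAlgebra
    rw [map_bind, hc.bind, map_map]
    congr 2
    exact map_congr S (fun x => by simp) p

theorem isHom_equivAlgebra_symm {M N : Type u} (e : M ≃ N) (c : S.obj N → N) :
    IsHom S c (equivAlgebra e c) e.symm := fun p => by
  unfold equivAlgebra
  rw [map_map, show S.map (↾(e ∘ e.symm)) p = p from map_id S.toFunctor _ (fun x => by simp) p]

theorem exists_equiv_extending {L M N : Type u} {i : L → M} {j : L → N}
    (hi : Function.Injective i) (hj : Function.Injective j) (hL : #L < #M) (hMN : #M = #N) :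
    ∃ e : M ≃ N, ∀ l, e (i l) = j l := by
  obtain ⟨e, he⟩ := extend_function_of_lt (s := Set.range i)
    ⟨j ∘ (Equiv.ofInjective i hi).symm, hj.comp (Equiv.injective _)⟩
    (by rwa [mk_range_eq i hi]) (Cardinal.eq.1 hMN)
  refine ⟨e, fun l => (he ⟨i l, l, rfl⟩).trans ?_⟩
  change j ((Equiv.ofInjective i hi).symm _) = j l
  rw [Equiv.ofInjective_symm_apply]

/-- Replace both algebras by powers over a large index set `J`, embedded diagonally. The powers have
the same cardinality, strictly above that of `L`, so the identification along `L` extends to a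
bijection, which transports one structure to the other carrier. -/
theorem exists_amalgam {L M N : Type u} [Nontrivial M] [Nontrivial N] {b : S.obj M → M}
    {c : T.obj N → N} (hb : IsAlgebra S b) (hc : IsAlgebra T c) {i : L → M} {j : L → N}
    (hi : Function.Injective i) (hj : Function.Injective j) :
    ∃ (B : Type u) (b' : S.obj B → B) (c' : T.obj B → B) (m : M → B) (n : N → B),
      IsAlgebra S b' ∧ IsAlgebra T c' ∧ IsHom S b b' m ∧ IsHom T c c' n ∧
      Function.Injective m ∧ Function.Injective n ∧ ∀ l, m (i l) = n (j l) := by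
  -- `J` is infinite and at least as large as `M` and `N`, so both powers have cardinality `2 ^ #J`.
  let J : Type u := ULift.{u} ℕ ⊕ (M ⊕ N)
  have hJ : ℵ₀ ≤ #J := by
    rw [← infinite_iff]; infer_instance
  have hM : #M ≤ #J := mk_le_of_injective (Sum.inr_injective.comp Sum.inl_injective)
  have hN : #N ≤ #J := mk_le_of_injective (Sum.inr_injective.comp Sum.inr_injective)
  have h2M : 2 ≤ #M := two_le_iff.2 (exists_pair_ne M)
  have h2N : 2 ≤ #N := two_le_iff.2 (exists_pair_ne N)
  have hpM : #(J → M) = 2 ^ #J := by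
    rw [← power_def, power_eq_two_power hJ h2M hM]
  have hpN : #(J → N) = 2 ^ #J := by
    rw [← power_def, power_eq_two_power hJ h2N hN]
  have hL : #L < #(J → M) := by
    rw [hpM]
    exact ((mk_le_of_injective hi).trans hM).trans_lt (cantor _)
  have hd : ∀ Z : Type u, Function.Injective (fun (z : Z) (_ : J) => z) := fun Z z z' h =>
    congrFun h (Sum.inl ⟨0⟩)
  obtain ⟨e, he⟩ := exists_equiv_extending ((hd M).comp hi) ((hd N).comp hj) hL
    (hpM.trans hpN.symm)
  refine ⟨J → M, powAlgebra J b, equivAlgebra e (powAlgebra J c), fun x _ => x,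
    e.symm ∘ fun x _ => x, hb.powAlgebra J, (hc.powAlgebra J).equivAlgebra e, isHom_const J b,
    (isHom_equivAlgebra_symm e _).comp (isHom_const J c), hd M, e.symm.injective.comp (hd N),
    fun l => ?_⟩
  exact (e.symm_apply_eq.2 (he l).symm).symm

/-! ### Terms from a coproduct -/

theorem exists_alternatingTerms [HasBinaryCoproduct S T] (hS : IsConsistent S)
    (hT : IsConsistent T) (A : Type u) [Infinite A] :
    ∃ X Y : Type u, Nonempty (AlternatingTerms S T A X Y) := by
  let W : Type u := (S ⨿ T).obj A
  let s : S.obj W → W := inducedAlgebra coprod.inl A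
  let t : T.obj W → W := inducedAlgebra coprod.inr A
  let α : A → W := (S ⨿ T).η.app A
  -- `U` and `V` are the values in `W` of alternating terms headed by `S` and by `T`; at this point
  -- they might overlap or meet the generators.
  obtain ⟨U, V, ρ, hr⟩ := exists_isResolved hS hT
    (fun p : S.obj (A ⊕ W) => s (S.map (↾(Sum.elim α id)) p))
    (fun p : T.obj (A ⊕ W) => t (T.map (↾(Sum.elim α id)) p))
  choose p hp hpu using hr.supp_s
  choose q hq hqv using hr.supp_t
  have injs : ∀ u : W, Function.Injective
      (Sum.map id Subtype.val : A ⊕ {v : V // ρ (Sum.inr v) < ρ (Sum.inl u)} → A ⊕ V) := fun u =>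
    Sum.map_injective.2 ⟨Function.injective_id, Subtype.val_injective⟩
  have injt : ∀ v : W, Function.Injective
      (Sum.map id Subtype.val : A ⊕ {u : U // ρ (Sum.inl u) < ρ (Sum.inr v)} → A ⊕ U) := fun u =>
    Sum.map_injective.2 ⟨Function.injective_id, Subtype.val_injective⟩
  let σ : U → S.obj (A ⊕ V) := fun u => S.map (↾(Sum.map id Subtype.val)) (p u u.2)
  let τ : V → T.obj (A ⊕ U) := fun v => T.map (↾(Sum.map id Subtype.val)) (q v v.2)
  have hσ : ∀ u, s (S.map (↾(Sum.elim α Subtype.val)) (σ u)) = u := fun u => by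
    refine Eq.trans (congrArg s ?_) (hpu u u.2)
    dsimp only [σ]
    rw [map_map, map_map]
    exact map_congr S (fun z => by cases z <;> rfl) _
  have hτ : ∀ v, t (T.map (↾(Sum.elim α Subtype.val)) (τ v)) = v := fun v => by
    refine Eq.trans (congrArg t ?_) (hqv v v.2)
    dsimp only [τ]
    rw [map_map, map_map]
    exact map_congr T (fun z => by cases z <;> rfl) _
  have hσ' : ∀ u, σ u ∉ Set.range (S.η.app _) := fun u =>
    map_notMem_range_eta hS (injs _) (hp u u.2)
  have hτ' : ∀ v, τ v ∉ Set.range (T.η.app _) := fun v =>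
    map_notMem_range_eta hT (injt _) (hq v v.2)
  -- In `S (A ⊕ V)` an element of `U` is represented by a chosen term and one of `V` by a variable;
  -- `j` does the reverse. The amalgam identifies the two representations.
  let i : A ⊕ (U ⊕ V) → S.obj (A ⊕ V) := Sum.elim (fun a => S.η.app _ (Sum.inl a))
    (Sum.elim σ fun v => S.η.app _ (Sum.inr v))
  let j : A ⊕ (U ⊕ V) → T.obj (A ⊕ U) := Sum.elim (fun a => T.η.app _ (Sum.inl a))
    (Sum.elim (fun u => T.η.app _ (Sum.inr u)) τ)
  have hi : Function.Injective i := by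
    refine ((hS _).comp Sum.inl_injective).sumElim (Function.Injective.sumElim ?_
      ((hS _).comp Sum.inr_injective) ?_) ?_
    · intro u u' h
      have h1 := hσ u
      rw [h, hσ] at h1
      exact Subtype.ext h1.symm
    · exact fun u v h => hσ' u ⟨_, h.symm⟩
    · rintro a (u | v) h
      · exact hσ' u ⟨_, h⟩
      · cases hS _ h
  have hj : Function.Injective j := by
    refine ((hT _).comp Sum.inl_injective).sumElim (Function.Injective.sumElim
      ((hT _).comp Sum.inr_injective) ?_ ?_) ?_
    · intro u u' h
      have h1 := hτ u
      rw [h, hτ] at h1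
      exact Subtype.ext h1.symm
    · exact fun u v h => hτ' v ⟨_, h⟩
    · rintro a (u | v) h
      · cases hT _ h
      · exact hτ' v ⟨_, h⟩
  have : Nontrivial (S.obj (A ⊕ V)) := (hi.comp Sum.inl_injective).nontrivial
  have : Nontrivial (T.obj (A ⊕ U)) := (hj.comp Sum.inl_injective).nontrivial
  obtain ⟨B, b, c, m, n, hb, hc, hm, hn, hmi, hni, hmn⟩ :=
    exists_amalgam (isAlgebra_bind_id (S := S) (A ⊕ V)) (isAlgebra_bind_id (S := T) (A ⊕ U)) hi hj
  obtain ⟨h, hα, hhs, hht⟩ := exists_isHom_coprod hb hc fun a => m (i (Sum.inl a))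
  -- By induction on rank, the homomorphism from `W` sends each value to its representative in the
  -- amalgam.
  have key : ∀ z : U ⊕ V, h (Sum.elim Subtype.val Subtype.val z) = m (i (Sum.inr z)) := by
    intro z
    induction z using (InvImage.wf (fun z : U ⊕ V => ρ (Sum.map Subtype.val Subtype.val z))
      Ordinal.lt_wf).induction with
    | _ z ih =>
      rcases z with u | v
      · change h u = m (σ u)
        rw [hm.apply_free, ← hσ u, hhs, map_map]
        dsimp only [σ]
        rw [map_map, map_map]
        congr 1
        refine map_congr S (fun z => ?_) _
        rcases z with a | v
        · exact hα a
        · exact ih (Sum.inr v.1) v.2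
      · rw [hmn]
        change h v = n (τ v)
        rw [hn.apply_free, ← hτ v, hht, map_map]
        dsimp only [τ]
        rw [map_map, map_map]
        congr 1
        refine map_congr T (fun z => ?_) _
        rcases z with a | u
        · exact (hα a).trans (hmn _)
        · exact (ih (Sum.inl u.1) u.2).trans (hmn _)
  refine ⟨U, V, hr.nonempty_alternatingTerms hS hT ?_ ?_⟩
  -- Evaluating in `W` and then applying `h` is the embedding `m`, so evaluation is injective.
  · have h1 : ∀ p : S.obj (A ⊕ V), h (s (S.map (↾(Sum.elim α id))
        (S.map (↾(Sum.map id Subtype.val)) p))) = m p := fun p => by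
      rw [hm.apply_free, hhs, map_map, map_map]
      congr 1
      refine map_congr S (fun z => ?_) _
      rcases z with a | v
      · exact hα a
      · exact key (Sum.inr v)
    intro p q _ _ hpq
    apply hmi
    rw [← h1, ← h1]
    exact congrArg h hpq
  · have h1 : ∀ p : T.obj (A ⊕ U), h (t (T.map (↾(Sum.elim α id))
        (T.map (↾(Sum.map id Subtype.val)) p))) = n p := fun p => by
      rw [hn.apply_free, hht, map_map, map_map]
      congr 1
      refine map_congr T (fun z => ?_) _
      rcases z with a | u
      · exact (hα a).trans (hmn _)
      · exact (key (Sum.inl u)).trans (hmn _)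
    intro p q _ _ hpq
    apply hni
    rw [← h1, ← h1]
    exact congrArg h hpq

/-! ### Substantially exceptional monads -/

variable {S : Monad (Type u)}

theorem IsSubstantiallyExceptional.exists_injOn (h : IsSubstantiallyExceptional S) :
    ∃ E : Type u, ∀ Y : Type u, ∃ s : S.obj Y → E, Set.InjOn s (Set.range (S.η.app Y))ᶜ := by
  obtain ⟨E, ⟨e⟩⟩ := h
  -- The extra point receives the variables, on which `s` need not be injective.
  refine ⟨Option E, fun Y => ?_⟩
  let k : S.obj Y → E ⊕ Y := fun p =>
    (Types.binaryCoproductIso E Y).hom (e.hom.app Y (trnkovaReflection S.toFunctor Y p))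
  have hk : Function.Injective k := by
    intro p q hpq
    have h1 : Function.Injective (e.hom.app Y) := by
      intro x y hxy
      have h2 := congrArg (e.inv.app Y) hxy
      have h3 : ∀ z, e.inv.app Y (e.hom.app Y z) = z := fun z =>
        congrArg (fun f : trnkovaClosure S ⟶ trnkovaClosure S => f.app Y z) e.hom_inv_id
      rwa [h3, h3] at h2
    have h2 := h1 ((Types.binaryCoproductIso E Y).toEquiv.injective hpq)
    exact map_injective S (Option.some_injective Y) (congrArg Subtype.val h2)
  have hη : ∀ y, k (S.η.app Y y) = Sum.inr y := by
    intro y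
    have h1 : e.hom.app Y (trnkovaReflection S.toFunctor Y (S.η.app Y y)) =
        (coprod.inr : Y ⟶ E ⨿ Y) y := hom_eta e.hom y
    change (Types.binaryCoproductIso E Y).hom (e.hom.app Y _) = _
    rw [h1]
    exact ConcreteCategory.congr_hom (Types.binaryCoproductIso_inr_comp_hom E Y) y
  refine ⟨fun p => Sum.elim some (fun _ => none) (k p), fun p hp q hq hpq => hk ?_⟩
  rcases h1 : k p with x | y
  · rcases h2 : k q with x' | y'
    · simpa [h1, h2] using hpq
    · exact absurd ⟨y', hk ((hη y').trans h2.symm)⟩ hq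
  · exact absurd ⟨y, hk ((hη y).trans h1.symm)⟩ hp

/-- Elements of the Trnková closure at the empty set act as constants. -/
def closureConst (S : Monad (Type u)) (X : Type u) (e : TrnkovaObj S.toFunctor PEmpty.{u + 1}) :
    TrnkovaObj S.toFunctor X :=
  trnkovaMap S.toFunctor PEmpty.elim e

theorem closureBind_const {X Y : Type u} (f : X → TrnkovaObj S.toFunctor Y)
    (e : TrnkovaObj S.toFunctor PEmpty.{u + 1}) :
    closureBind S f (closureConst S X e) = closureConst S Y e := by
  unfold closureConst
  rw [closureBind_map, trnkovaMap_eq]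
  exact congrArg (fun k => closureBind S k e) (funext fun x => x.elim)

theorem trnkovaMap_const {X Y : Type u} (f : X → Y) (e : TrnkovaObj S.toFunctor PEmpty.{u + 1}) :
    trnkovaMap S.toFunctor f (closureConst S X e) = closureConst S Y e := by
  rw [trnkovaMap_eq, closureBind_const]

/-- The comparison from the exception monad to the Trnková closure. -/
noncomputable def exceptionComparison (S : Monad (Type u)) (X : Type u) :
    TrnkovaObj S.toFunctor PEmpty.{u + 1} ⨿ X ⟶ TrnkovaObj S.toFunctor X :=
  coprod.desc (↾(closureConst S X)) (↾(closureUnit S))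

theorem trnkovaObj_val_ne_eta_none (hS : IsConsistent S) {X : Type u}
    (p : TrnkovaObj S.toFunctor X) : p.1 ≠ S.η.app (Option X) none := by
  intro h
  have h1 := p.2
  rw [h, map_eta, map_eta] at h1
  cases hS _ h1

/-- If non-variables ignore relabelling, a non-variable of the closure is recovered from its image
under collapsing `X + 1` to the extra point, so it is a constant from the closure at the empty set.
The remaining elements are units. -/
theorem bijective_elim_closure (hS : IsConsistent S)
    (h : ∀ {X C : Type u} (p : S.obj X), p ∉ Set.range (S.η.app X) → ∀ f g : X → C,
      S.map (↾f) p = S.map (↾g) p) (X : Type u) :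
    Function.Bijective (Sum.elim (closureConst S X) (closureUnit S)) := by
  have hc : ∀ e : TrnkovaObj S.toFunctor PEmpty.{u + 1},
      S.map (↾fun _ : Option X => (none : Option PEmpty.{u + 1})) (closureConst S X e).1 = e.1 :=
    fun e => by
      unfold closureConst trnkovaMap
      rw [map_map]
      exact map_id S.toFunctor _ (fun x => by rcases x with _ | x; exacts [rfl, x.elim]) e.1
  constructor
  · refine Function.Injective.sumElim ?_ ?_ ?_
    · intro e e' he
      refine Subtype.ext ?_
      rw [← hc, ← hc e', he]
    · intro x x' hx
      have h1 := congrArg Subtype.val hx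
      rw [closureUnit_val, closureUnit_val] at h1
      exact Option.some_injective _ (hS _ h1)
    · intro e x he
      have h1 := hc e
      rw [he, closureUnit_val, map_eta] at h1
      exact trnkovaObj_val_ne_eta_none hS e h1.symm
  · intro p
    by_cases hp : p.1 ∈ Set.range (S.η.app (Option X))
    · obtain ⟨o, ho⟩ := hp
      rcases o with _ | x
      · exact absurd ho.symm (trnkovaObj_val_ne_eta_none hS p)
      · exact ⟨Sum.inr x, Subtype.ext ((closureUnit_val S x).trans ho)⟩
    · refine ⟨Sum.inl ⟨S.map (↾fun _ : Option X => none) p.1, ?_⟩, Subtype.ext ?_⟩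
      · rw [map_map, map_map]
        exact h _ hp _ _
      · change S.map (↾_) (S.map (↾_) p.1) = p.1
        rw [map_map]
        exact (h _ hp _ id).trans (map_id S.toFunctor id (fun _ => rfl) p.1)

theorem isSubstantiallyExceptional_of_map_eq (hS : IsConsistent S)
    (h : ∀ {X C : Type u} (p : S.obj X), p ∉ Set.range (S.η.app X) → ∀ f g : X → C,
      S.map (↾f) p = S.map (↾g) p) : IsSubstantiallyExceptional S := by
  let E := TrnkovaObj S.toFunctor PEmpty.{u + 1}
  have hiso : ∀ X, IsIso (exceptionComparison S X) := fun X => by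
    have h1 : exceptionComparison S X = (Types.binaryCoproductIso E X).hom ≫
        ↾(Sum.elim (closureConst S X) (closureUnit S)) := by
      refine coprod.hom_ext ?_ ?_
      · rw [← Category.assoc, Types.binaryCoproductIso_inl_comp_hom]
        exact coprod.inl_desc _ _
      · rw [← Category.assoc, Types.binaryCoproductIso_inr_comp_hom]
        exact coprod.inr_desc _ _
    have h2 : IsIso (↾(Sum.elim (closureConst S X) (closureUnit S))) :=
      (isIso_iff_bijective _).2 (bijective_elim_closure hS h X)
    rw [h1]
    infer_instance
  let φ : coprodMonad E ≅ trnkovaClosure S := MonadIso.mk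
    (NatIso.ofComponents (fun X => @asIso _ _ _ _ (exceptionComparison S X) (hiso X))
      (fun {X Y} f => by
        change coprod.map (𝟙 E) f ≫ exceptionComparison S Y =
          exceptionComparison S X ≫ ↾(trnkovaMap S.toFunctor f)
        refine coprod.hom_ext ?_ ?_
        · rw [coprod.inl_map_assoc, Category.id_comp]
          refine (coprod.inl_desc _ _).trans ?_
          refine Eq.trans ?_ (coprod.inl_desc_assoc _ _ _).symm
          ext e
          exact (trnkovaMap_const f e).symm
        · rw [coprod.inr_map_assoc]
          refine (congrArg (f ≫ ·) (coprod.inr_desc _ _)).trans ?_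
          refine Eq.trans ?_ (coprod.inr_desc_assoc _ _ _).symm
          exact (trnkovaClosure S).η.naturality f))
    (fun X => coprod.inr_desc _ _)
    (fun X => by
      change coprod.desc coprod.inl (𝟙 _) ≫ exceptionComparison S X =
        (coprod.map (𝟙 E) (exceptionComparison S X) ≫ exceptionComparison S _) ≫
          ↾(closureBind S id)
      refine coprod.hom_ext ?_ ?_
      · rw [coprod.inl_desc_assoc, Category.assoc, coprod.inl_map_assoc, Category.id_comp]
        refine (coprod.inl_desc _ _).trans ?_
        refine Eq.trans ?_ (coprod.inl_desc_assoc _ _ _).symm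
        ext e
        exact (closureBind_const id e).symm
      · rw [coprod.inr_desc_assoc, Category.assoc, coprod.inr_map_assoc, Category.id_comp]
        refine Eq.trans ?_ (congrArg (exceptionComparison S X ≫ ·)
          (coprod.inr_desc_assoc _ _ _).symm)
        refine Eq.trans ?_ (congrArg (exceptionComparison S X ≫ ·)
          ((trnkovaClosure S).left_unit X).symm)
        exact (Category.comp_id _).symm)
  exact ⟨E, ⟨φ.symm⟩⟩

/-- A monad that is not substantially exceptional has many terms that are not variables. -/
theorem exists_injective_nonunits (hS : IsConsistent S) (h : ¬ IsSubstantiallyExceptional S) :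
    ∃ κ : Cardinal.{u}, ∀ (Z : Type u) [Infinite Z], κ ≤ #Z →
      ∃ g : Z → S.obj Z, Function.Injective g ∧ ∀ z, g z ∉ Set.range (S.η.app Z) := by
  have h1 : ∃ (X C : Type u) (p : S.obj X) (f g : X → C), p ∉ Set.range (S.η.app X) ∧
      S.map (↾f) p ≠ S.map (↾g) p := by
    by_contra! hcon
    exact h (isSubstantiallyExceptional_of_map_eq hS fun p hp f g => hcon _ _ p f g hp)
  obtain ⟨X, C, p, f, g, hp, hfg⟩ := h1
  refine ⟨#X, fun Z _ hZ => ?_⟩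
  have : Nonempty X := by
    by_contra hX
    rw [not_nonempty_iff] at hX
    exact hfg (map_congr S (fun x => isEmptyElim x) p)
  -- `Z` splits into `Z` many disjoint copies of `X`, each carrying a copy of `p`.
  have hcard : #(X × Z) = #Z := by
    rw [← mul_def, mul_eq_right (aleph0_le_mk Z) hZ (mk_ne_zero X)]
  obtain ⟨e⟩ := Cardinal.eq.1 hcard
  refine ⟨fun z => S.map (↾fun x => e (x, z)) p, fun z z' hz => ?_, fun z =>
    map_notMem_range_eta hS (fun x x' hx => congrArg Prod.fst (e.injective hx)) hp⟩
  classical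
  by_contra hne
  -- Applying `f` on block `z` and `g` elsewhere separates the copies of `p`.
  have h2 := congrArg (S.map (↾fun w => if (e.symm w).2 = z then f (e.symm w).1
    else g (e.symm w).1)) hz
  rw [map_map, map_map] at h2
  refine hfg (Eq.trans ?_ (h2.trans ?_))
  · exact map_congr S (fun x => by simp) p
  · exact map_congr S (fun x => by simp [Ne.symm hne]) p

/-! ### Joint fixpoints -/

theorem mk_map_congr (S : Monad (Type u)) {X Y : Type u} (h : #X = #Y) :
    #(S.obj X) = #(S.obj Y) := by
  obtain ⟨e⟩ := Cardinal.eq.1 h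
  exact mk_congr (S.mapIso e.toIso).toEquiv

variable {T : Monad (Type u)}

/-- Variables occupy `A` and `Y` under `D.s`, so non-variables must land in `X`. -/
theorem AlternatingTerms.mk_le {A X Y : Type u} (D : AlternatingTerms S T A X Y)
    {g : A ⊕ Y → S.obj (A ⊕ Y)} (hg : Function.Injective g)
    (hg' : ∀ z, g z ∉ Set.range (S.η.app (A ⊕ Y))) : #(A ⊕ Y) ≤ #X := by
  have h : ∀ z, ∃ x, D.s (g z) = Sum.inr (Sum.inl x) := by
    intro z
    rcases hz : D.s (g z) with a | x | y
    · refine absurd ⟨Sum.inl a, D.s.injective ?_⟩ (hg' z)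
      rw [D.s_unit, hz]; rfl
    · exact ⟨x, rfl⟩
    · refine absurd ⟨Sum.inr y, D.s.injective ?_⟩ (hg' z)
      rw [D.s_unit, hz]; rfl
  choose k hk using h
  refine mk_le_of_injective (f := k) fun z z' hz => hg (D.s.injective ?_)
  rw [hk, hk, hz]

/-- Interchange of the roles of the two monads. -/
def AlternatingTerms.symm {A X Y : Type u} (D : AlternatingTerms S T A X Y) :
    AlternatingTerms T S A Y X where
  s := D.t.trans (Equiv.sumCongr (Equiv.refl _) (Equiv.sumComm _ _))
  t := D.s.trans (Equiv.sumCongr (Equiv.refl _) (Equiv.sumComm _ _))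
  s_unit z := by
    rw [Equiv.trans_apply, D.t_unit]
    cases z <;> rfl
  t_unit z := by
    rw [Equiv.trans_apply, D.s_unit]
    cases z <;> rfl
  ρ z := D.ρ z.swap
  s_supp y := by
    obtain ⟨p, hp⟩ := D.t_supp y
    exact ⟨p, congrArg (Equiv.sumCongr (Equiv.refl _) (Equiv.sumComm _ _)) hp⟩
  t_supp x := by
    obtain ⟨p, hp⟩ := D.s_supp x
    exact ⟨p, congrArg (Equiv.sumCongr (Equiv.refl _) (Equiv.sumComm _ _)) hp⟩

theorem AlternatingTerms.isFixpoint {A X Y : Type u} [Infinite A] (D : AlternatingTerms S T A X Y)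
    (hX : #(A ⊕ Y) ≤ #X) (hY : #(A ⊕ X) ≤ #Y) : IsFixpoint S.toFunctor #X := by
  have hAX : #A ≤ #X := (mk_le_of_injective Sum.inl_injective).trans hX
  have hXY : #Y = #X := le_antisymm ((mk_le_of_injective Sum.inr_injective).trans hX)
    ((mk_le_of_injective Sum.inr_injective).trans hY)
  have hX0 : ℵ₀ ≤ #X := (aleph0_le_mk A).trans hAX
  have hAY : #(A ⊕ Y) = #X := by
    refine le_antisymm hX ?_
    rw [← hXY]
    exact mk_le_of_injective Sum.inr_injective
  unfold IsFixpoint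
  rw [mk_map_congr S ((mk_out #X).trans hAY.symm), mk_congr D.s]
  rw [← add_def, ← add_def, hXY, add_eq_self hX0, add_eq_right hX0 hAX]

theorem haveArbitrarilyLargeJointFixpoints (hS : IsConsistent S) (hT : IsConsistent T)
    [HasBinaryCoproduct S T] (hSE : ¬ IsSubstantiallyExceptional S)
    (hTE : ¬ IsSubstantiallyExceptional T) :
    HaveArbitrarilyLargeJointFixpoints S.toFunctor T.toFunctor := by
  intro κ
  obtain ⟨κS, hκS⟩ := exists_injective_nonunits hS hSE
  obtain ⟨κT, hκT⟩ := exists_injective_nonunits hT hTE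
  -- `A` is infinite, above `κ`, and beyond the thresholds for many non-variables in both monads.
  let A : Type u := (max (max κ ℵ₀) (max κS κT)).out
  have hA : #A = max (max κ ℵ₀) (max κS κT) := mk_out _
  have : Infinite A := by
    rw [infinite_iff, hA]
    exact (le_max_right _ _).trans (le_max_left _ _)
  obtain ⟨X, Y, ⟨D⟩⟩ := exists_alternatingTerms hS hT A
  have hle : ∀ Z : Type u, #A ≤ #(A ⊕ Z) := fun Z => mk_le_of_injective Sum.inl_injective
  have hX : #(A ⊕ Y) ≤ #X := by
    obtain ⟨g, hg, hg'⟩ := hκS (A ⊕ Y) (le_trans (by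
      rw [hA]; exact (le_max_left _ _).trans (le_max_right _ _)) (hle Y))
    exact D.mk_le hg hg'
  have hY : #(A ⊕ X) ≤ #Y := by
    obtain ⟨g, hg, hg'⟩ := hκT (A ⊕ X) (le_trans (by
      rw [hA]; exact (le_max_right _ _).trans (le_max_right _ _)) (hle X))
    exact D.symm.mk_le hg hg'
  have hXY : #Y = #X := le_antisymm ((mk_le_of_injective Sum.inr_injective).trans hX)
    ((mk_le_of_injective Sum.inr_injective).trans hY)
  refine ⟨#X, ?_, D.isFixpoint hX hY, hXY ▸ D.symm.isFixpoint hY hX⟩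
  refine le_trans ?_ ((hle Y).trans hX)
  rw [hA]
  exact (le_max_left _ _).trans (le_max_left _ _)

theorem hasBinaryCoproduct_of_jointFixpoints (hS : IsConsistent S) (hT : IsConsistent T)
    (h : HaveArbitrarilyLargeJointFixpoints S.toFunctor T.toFunctor) :
    HasBinaryCoproduct S T := by
  refine hasBinaryCoproduct_of_injOn hS hT fun A => ?_
  obtain ⟨l, hl, hlS, hlT⟩ := h (max #A ℵ₀)
  have hA : #(A ⊕ l.out) = #l.out := by
    rw [← add_def, mk_out]
    exact add_eq_right ((le_max_right _ _).trans hl) ((le_max_left _ _).trans hl)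
  obtain ⟨s⟩ := Cardinal.eq.1 (((mk_map_congr S hA).trans hlS).trans (mk_out l).symm)
  obtain ⟨t⟩ := Cardinal.eq.1 (((mk_map_congr T hA).trans hlT).trans (mk_out l).symm)
  exact ⟨l.out, l.out, s, t, s.injective.injOn, t.injective.injOn⟩

end SetMonad

theorem mainTheorem5 (S T : CategoryTheory.Monad (Type u))
    (hS : SetMonad.IsConsistent S) (hT : SetMonad.IsConsistent T) :
    CategoryTheory.Limits.HasBinaryCoproduct S T ↔
      SetMonad.IsSubstantiallyExceptional S ∨ SetMonad.IsSubstantiallyExceptional T ∨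
        SetMonad.HaveArbitrarilyLargeJointFixpoints S.toFunctor T.toFunctor := by
  constructor
  · intro h
    by_cases hSE : SetMonad.IsSubstantiallyExceptional S
    · exact Or.inl hSE
    by_cases hTE : SetMonad.IsSubstantiallyExceptional T
    · exact Or.inr (Or.inl hTE)
    exact Or.inr (Or.inr (SetMonad.haveArbitrarilyLargeJointFixpoints hS hT hSE hTE))
  · rintro (h | h | h)
    · obtain ⟨E, hE⟩ := h.exists_injOn
      refine SetMonad.hasBinaryCoproduct_of_injOn hS hT fun A => ?_
      obtain ⟨s, hs⟩ := hE (A ⊕ T.obj (A ⊕ E))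
      -- There is no circularity: `E` bounds the non-variables of `S` over every set, so `Y` can be
      -- defined from it.
      exact ⟨E, T.obj (A ⊕ E), s, id, hs, Function.injective_id.injOn⟩
    · obtain ⟨E, hE⟩ := h.exists_injOn
      refine SetMonad.hasBinaryCoproduct_of_injOn hS hT fun A => ?_
      obtain ⟨t, ht⟩ := hE (A ⊕ S.obj (A ⊕ E))
      exact ⟨S.obj (A ⊕ E), E, id, t, Function.injective_id.injOn, ht⟩
    · exact SetMonad.hasBinaryCoproduct_of_jointFixpoints hS hT h
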